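/- Let $A$ be a ring, let $\mathrm{Mod}\,A$ be the category of left $A$-modules with derived category $D(\mathrm{Mod}\,A)$, and let $P^\bullet$ be a complex of finitely generated projective left $A$-modules with $P^i = 0$ for $i \neq -1, 0$. Define full subcategories of $\mathrm{Mod}\,A$ by $$\mathcal{X}(P^\bullet) = \{ M : \mathrm{Hom}_{D(\mathrm{Mod}\,A)}(P^\bullet, M[1]) = 0 \}, \qquad \mathcal{Y}(P^\bullet) = \{ M : \mathrm{Hom}_{D(\mathrm{Mod}\,A)}(P^\bullet, M) = 0 \}.$$ A tilting complex for $A$ is a bounded complex $T^\bullet$ of finitely generated projective left $A$-modules such that $\mathrm{Hom}_{K(\mathrm{Mod}\,A)}(T^\bullet, T^\bullet[n]) = 0$ for all $n \neq 0$, where $K(\mathrm{Mod}\,A)$ is the homotopy category of complexes, and such that the subcategory $\mathrm{add}(T^\bullet)$ of direct summands of finite direct sums of copies of $T^\bullet$ generates $K^b(\mathrm{proj}\,A)$, the homotopy category of bounded complexes of finitely generated projective modules, as a triangulated category. A pair $(\mathcal{X}, \mathcal{Y})$ of full subcategories of an abelian category $\mathcal{A}$ is a torsion theory for $\mathcal{A}$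 if $\mathcal{X} \cap \mathcal{Y} = \{0\}$, $\mathcal{X}$ is closed under factor objects, $\mathcal{Y}$ is closed under subobjects, and for every object $M$ of $\mathcal{A}$ there is an exact sequence $0 \to M' \to M \to M'' \to 0$ with $M' \in \mathcal{X}$ and $M'' \in \mathcal{Y}$. Then the following are equivalent. 1. $P^\bullet$ is a tilting complex. 2. $\mathcal{X}(P^\bullet) \cap \mathcal{Y}(P^\bullet) = \{0\}$, $H^0(P^\bullet) \in \mathcal{X}(P^\bullet)$ and $H^{-1}(P^\bullet) \in \mathcal{Y}(P^\bullet)$. 3. $(\mathcal{X}(P^\bullet), \mathcal{Y}(P^\bullet))$ is a torsion theory for $\mathrm{Mod}\,A$ and $H^{-1}(P^\bullet) \in \mathcal{Y}(P^\bullet)$. -/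

import Mathlib

open CategoryTheory CategoryTheory.Limits

universe w v u

noncomputable section

namespace TwoTermTilting

/-- A pair `(X, Y)` of full subcategories of an abelian category is a torsion theory if
`X ∩ Y = {0}`, `X` is closed under factor objects, `Y` is closed under subobjects, and every
object `M` sits in a short exact sequence `0 ⟶ M' ⟶ M ⟶ M'' ⟶ 0` with `M'` in `X` and
`M''` in `Y`. -/
structure IsTorsionTheory {C : Type u} [Category.{v} C] [Abelian C]
    (X Y : ObjectProperty C) : Prop where
  inter_eq_zero : X ⊓ Y = IsZero
  quotient_closed : X.IsClosedUnderQuotients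
  subobject_closed : Y.IsClosedUnderSubobjects
  exists_sequence : ∀ M : C, ∃ (M' M'' : C) (i : M' ⟶ M) (p : M ⟶ M'') (zero : i ≫ p = 0),
    (ShortComplex.mk i p zero).ShortExact ∧ X M' ∧ Y M''

variable {A : Type u} [Ring A]

/-- The class `X(P)` of modules `M` with `Hom(P, M[1]) = 0` in the derived category. -/
def classX [HasDerivedCategory.{w} (ModuleCat.{u} A)]
    (P : CochainComplex (ModuleCat.{u} A) ℤ) : ObjectProperty (ModuleCat.{u} A) :=
  fun M ↦ Subsingleton (DerivedCategory.Q.obj P ⟶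
    (shiftFunctor (DerivedCategory (ModuleCat.{u} A)) (1 : ℤ)).obj
      ((DerivedCategory.singleFunctor (ModuleCat.{u} A) 0).obj M))

/-- The class `Y(P)` of modules `M` with `Hom(P, M) = 0` in the derived category. -/
def classY [HasDerivedCategory.{w} (ModuleCat.{u} A)]
    (P : CochainComplex (ModuleCat.{u} A) ℤ) : ObjectProperty (ModuleCat.{u} A) :=
  fun M ↦ Subsingleton (DerivedCategory.Q.obj P ⟶
    (DerivedCategory.singleFunctor (ModuleCat.{u} A) 0).obj M)

/-- Bounded complexes of finitely generated projective modules. -/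
structure IsBoundedProj (K : CochainComplex (ModuleCat.{u} A) ℤ) : Prop where
  bounded : ∃ a b : ℤ, K.IsStrictlyGE a ∧ K.IsStrictlyLE b
  finite : ∀ i, Module.Finite A (K.X i)
  projective : ∀ i, Module.Projective A (K.X i)

/-- The class of a complex in the homotopy category of complexes of modules. -/
abbrev toK (K : CochainComplex (ModuleCat.{u} A) ℤ) :
    HomotopyCategory (ModuleCat.{u} A) (ComplexShape.up ℤ) :=
  (HomotopyCategory.quotient (ModuleCat.{u} A) (ComplexShape.up ℤ)).obj K

/-- The subcategory `add(T)` of the homotopy category: the direct summands of finite direct sums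
of copies of `T`. (In a triangulated category, every retract is a direct summand.) -/
def addClosure (T : CochainComplex (ModuleCat.{u} A) ℤ) :
    ObjectProperty (HomotopyCategory (ModuleCat.{u} A) (ComplexShape.up ℤ)) :=
  fun K ↦ ∃ (n : ℕ) (b : Bicone (fun _ : Fin n ↦ toK T)),
    Nonempty b.IsBilimit ∧ Nonempty (Retract K b.pt)

/-- Rickard's tilting complexes: a bounded complex `T` of finitely generated projective modules
such that `Hom(T, T[n]) = 0` in the homotopy category for all `n ≠ 0`, and `add(T)` generates
`Kᵇ(proj A)` as a triangulated category. The last condition says that every full triangulated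
subcategory (closed under isomorphisms) which contains `add(T)` contains `Kᵇ(proj A)`. Here
`Kᵇ(proj A)` is seen as a full triangulated subcategory of the homotopy category of all complexes
of modules. -/
structure IsTiltingComplex (T : CochainComplex (ModuleCat.{u} A) ℤ) : Prop where
  isBoundedProj : IsBoundedProj T
  hom_shift_eq_zero : ∀ n : ℤ, n ≠ 0 → Subsingleton (toK T ⟶
    (shiftFunctor (HomotopyCategory (ModuleCat.{u} A) (ComplexShape.up ℤ)) n).obj (toK T))
  generates : ∀ S : ObjectProperty (HomotopyCategory (ModuleCat.{u} A) (ComplexShape.up ℤ)),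
    S.IsTriangulated → S.IsClosedUnderIsomorphisms → addClosure T ≤ S →
      ∀ K : CochainComplex (ModuleCat.{u} A) ℤ, IsBoundedProj K → S (toK K)

end TwoTermTilting

end

/-! Write `P` as `d : P₁ → P₀`. Since `P` is K-projective, maps out of it in the derived category
are homotopy classes. So `M` lies in `X(P)` when every map `P₁ → M` factors through `d`
(`PrecompSurj`), and in `Y(P)` when only the zero map `P₀ → M` kills `d` (`PrecompInj`).
Projectivity turns `H⁰(P) ∈ X(P)` into `Hom(P, P[1]) = 0` (`IsRigid`), and `H⁻¹(P) ∈ Y(P)` amounts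
to `Hom(P, P[-1]) = 0`; the other nonzero shifts vanish for degree reasons.

Tilting gives `X ∩ Y = 0`: if `N` lies in both classes, `P` is orthogonal to all shifts of `N`,
hence so is everything it generates, including `A`, and `N = 0`.

Torsion theory: the torsion part of `M` is the trace of `H⁰(P)`, the sum of the images of the maps
`P₀ → M` that kill `d`. Rigidity puts the trace in `X(P)` and the quotient in `Y(P)`. Conversely,
`H⁰(P)` has no nonzero quotient in `Y(P)`, so a torsion theory forces it into `X(P)`.

The hard point is generation. For a finitely generated projective `Q`, the universal map from copies
of `P` to `Q[1]` has a cocone `E`, and `H⁰(E)` lies in `X(P)`. As `X ∩ Y = 0`, `H⁰(E)` equals its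
trace, so `Q → E` factors, up to homotopy, through a finite sum `F` of copies of `P`. The connecting
map of the cone `D` of `Q → F` then factors through copies of `P`, and rigidity makes `D` a summand
of copies of `P`. The triangle `Q → F → D` generates `Q`; cutting off one degree at a time reaches
every bounded complex. The argument is carried by `IsRigid.exists_matrices`,
`prop_single_of_matrices` and `exists_sum_eq_id_of_distinguished`. -/

noncomputable section

namespace TwoTermTilting

/-! ### Module theory of a two-term complex: traces and the universal extension -/

section Modules

variable {A : Type u} [Ring A] {P₁ P₀ : Type u} [AddCommGroup P₁] [Module A P₁]
  [AddCommGroup P₀] [Module A P₀]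

/-- Every linear map `P₁ → M` factors through `d : P₁ → P₀`. -/
def PrecompSurj (d : P₁ →ₗ[A] P₀) (M : Type u) [AddCommGroup M] [Module A M] : Prop :=
  ∀ f : P₁ →ₗ[A] M, ∃ g : P₀ →ₗ[A] M, g ∘ₗ d = f

/-- Only the zero map `P₀ → M` vanishes on the image of `d : P₁ → P₀`. -/
def PrecompInj (d : P₁ →ₗ[A] P₀) (M : Type u) [AddCommGroup M] [Module A M] : Prop :=
  ∀ g : P₀ →ₗ[A] M, g ∘ₗ d = 0 → g = 0

/-- Every linear map `P₁ → P₀` is null-homotopic as a morphism of degree one from the two-term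
complex `d : P₁ → P₀` to itself. -/
def IsRigid (d : P₁ →ₗ[A] P₀) : Prop :=
  ∀ f : P₁ →ₗ[A] P₀, ∃ (h : P₁ →ₗ[A] P₁) (k : P₀ →ₗ[A] P₀), f = d ∘ₗ h + k ∘ₗ d

variable {d : P₁ →ₗ[A] P₀} {M N : Type u} [AddCommGroup M] [Module A M]
  [AddCommGroup N] [Module A N]

lemma PrecompSurj.of_surjective [Module.Projective A P₁] (hM : PrecompSurj d M)
    (p : M →ₗ[A] N) (hp : Function.Surjective p) : PrecompSurj d N := by
  intro f
  obtain ⟨f', hf'⟩ := Module.projective_lifting_property p f hp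
  obtain ⟨g, hg⟩ := hM f'
  exact ⟨p ∘ₗ g, by rw [LinearMap.comp_assoc, hg, hf']⟩

lemma PrecompInj.of_injective (hN : PrecompInj d N)
    (i : M →ₗ[A] N) (hi : Function.Injective i) : PrecompInj d M := by
  intro g hg
  have h := hN (i ∘ₗ g) (by rw [LinearMap.comp_assoc, hg, LinearMap.comp_zero])
  ext x
  exact hi (by simpa using LinearMap.congr_fun h x)

/-- A map from a projective module whose image lies in the range of `p` factors through `p`. -/
lemma exists_comp_eq_of_range_le {V W : Type u} [AddCommGroup V] [Module A V]
    [AddCommGroup W] [Module A W] [Module.Projective A V] (p : W →ₗ[A] M) (f : V →ₗ[A] M)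
    (h : ∀ v, f v ∈ LinearMap.range p) : ∃ g : V →ₗ[A] W, p ∘ₗ g = f := by
  obtain ⟨g, hg⟩ := Module.projective_lifting_property p.rangeRestrict (f.codRestrict _ h)
    p.surjective_rangeRestrict
  refine ⟨g, ?_⟩
  ext v
  simpa using congrArg Subtype.val (LinearMap.congr_fun hg v)

/-- A linear map from a finite module to a direct sum only involves finitely many summands. -/
lemma exists_finset_support_le {V W ι : Type u} [AddCommGroup V] [Module A V]
    [AddCommGroup W] [Module A W] [Module.Finite A V] (f : V →ₗ[A] (ι →₀ W)) :
    ∃ s : Finset ι, ∀ t, s ⊆ t → ∀ v, (f v).support ⊆ t := by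
  classical
  obtain ⟨S, hS⟩ := Module.Finite.fg_top (R := A) (M := V)
  refine ⟨S.biUnion fun v ↦ (f v).support, fun t ht v ↦ ?_⟩
  have hle : (⊤ : Submodule A V) ≤
      (Finsupp.supported W A (t : Set ι)).comap f := by
    rw [← hS, Submodule.span_le]
    intro v hv
    have : (f v).support ⊆ t :=
      (Finset.subset_biUnion_of_mem (fun v ↦ (f v).support) hv).trans ht
    simpa [Finsupp.mem_supported] using this
  simpa [Finsupp.mem_supported] using hle (Submodule.mem_top (x := v))

lemma Finsupp.eq_sum_single {W ι : Type u} [AddCommGroup W] (x : ι →₀ W) (s : Finset ι)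
    (h : x.support ⊆ s) : x = ∑ i ∈ s, Finsupp.single i (x i) := by
  rw [← Finsupp.sum_of_support_subset x h _ (by simp), Finsupp.sum_single]

/-- A finite sum of maps `P₁ → M` which factor through `d` factors through `d`. -/
lemma precompSurj_sum {ι : Type u} (s : Finset ι) (f : ι → (P₁ →ₗ[A] M))
    (h : ∀ i ∈ s, ∃ g : P₀ →ₗ[A] M, g ∘ₗ d = f i) :
    ∃ g : P₀ →ₗ[A] M, g ∘ₗ d = ∑ i ∈ s, f i := by
  choose! g hg using h
  exact ⟨∑ i ∈ s, g i, by
    rw [← Finset.sum_congr rfl hg]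
    ext x
    simp⟩

variable (d M) in
/-- The sum of all maps `P₀ → M` which vanish on the image of `d`. -/
def traceMap : ({g : P₀ →ₗ[A] M // g ∘ₗ d = 0} →₀ P₀) →ₗ[A] M :=
  -- The scalars are `ℕ` because `A` need not be commutative.
  Finsupp.lsum ℕ fun g ↦ g.1

lemma traceMap_single (g : {g : P₀ →ₗ[A] M // g ∘ₗ d = 0}) (x : P₀) :
    traceMap d M (Finsupp.single g x) = g.1 x := by
  simp [traceMap]

/-- A map from `P₁` lifts to finitely many copies of `P₀`. By rigidity each component is `d ∘ h + k
∘ d`; the first term dies under the trace map, and the second factors through `d`. -/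
lemma IsRigid.precompSurj_range_traceMap [Module.Projective A P₁] [Module.Finite A P₁]
    (hd : IsRigid d) : PrecompSurj d (LinearMap.range (traceMap d M)) := by
  intro f
  obtain ⟨f', hf'⟩ := Module.projective_lifting_property (traceMap d M).rangeRestrict f
    (traceMap d M).surjective_rangeRestrict
  obtain ⟨s, hs⟩ := exists_finset_support_le f'
  have key : f = ∑ i ∈ s, (traceMap d M).rangeRestrict ∘ₗ Finsupp.lsingle i ∘ₗ
      Finsupp.lapply i ∘ₗ f' := by
    ext x
    rw [← hf']
    conv_lhs => rw [LinearMap.comp_apply, Finsupp.eq_sum_single (f' x) s (hs s subset_rfl x)]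
    simp
  rw [key]
  refine precompSurj_sum s _ fun i _ ↦ ?_
  obtain ⟨h, k, hk⟩ := hd (Finsupp.lapply i ∘ₗ f')
  refine ⟨(traceMap d M).rangeRestrict ∘ₗ Finsupp.lsingle i ∘ₗ k, ?_⟩
  rw [hk]
  ext x
  have := LinearMap.congr_fun i.2 (h x)
  simp only [LinearMap.comp_apply, LinearMap.zero_apply] at this
  simp [traceMap_single, this]

/-- Lift `g` to `g' : P₀ → M`. Then `g' ∘ d` lands in the trace, hence equals `k ∘ d` with `k`
valued in the trace. The difference `g' - k` kills `d`, so its image is in the trace by definition,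
and so is that of `g'`. -/
lemma IsRigid.precompInj_quotient_range_traceMap [Module.Projective A P₁] [Module.Finite A P₁]
    [Module.Projective A P₀] (hd : IsRigid d) :
    PrecompInj d (M ⧸ LinearMap.range (traceMap d M)) := by
  intro g hg
  obtain ⟨g', hg'⟩ := Module.projective_lifting_property
    (LinearMap.range (traceMap d M)).mkQ g (Submodule.mkQ_surjective _)
  have hmem : ∀ x, g' (d x) ∈ LinearMap.range (traceMap d M) := fun x ↦ by
    rw [← Submodule.ker_mkQ (LinearMap.range (traceMap d M)), LinearMap.mem_ker,
      ← LinearMap.comp_apply, hg', ← LinearMap.comp_apply, hg, LinearMap.zero_apply]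
  obtain ⟨k, hk⟩ := hd.precompSurj_range_traceMap ((g' ∘ₗ d).codRestrict _ hmem)
  have h0 : (g' - (LinearMap.range (traceMap d M)).subtype ∘ₗ k) ∘ₗ d = 0 := by
    rw [LinearMap.sub_comp, LinearMap.comp_assoc, hk]
    ext x
    simp
  ext x
  rw [← hg', LinearMap.comp_apply, LinearMap.zero_apply, Submodule.mkQ_apply,
    Submodule.Quotient.mk_eq_zero]
  have h1 := traceMap_single (d := d) ⟨_, h0⟩ x
  have h2 : g' x = traceMap d M (Finsupp.single ⟨_, h0⟩ x) + k x := by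
    rw [h1]; simp
  rw [h2]
  exact Submodule.add_mem _ ⟨_, rfl⟩ (k x).2

/-- If no nonzero module lies in both classes of `d`, then a module through which all maps from
`P₁` factor is generated by the cokernel of `d`. -/
lemma IsRigid.traceMap_surjective [Module.Projective A P₁] [Module.Finite A P₁]
    [Module.Projective A P₀] (hd : IsRigid d)
    (hz : ∀ (N : Type u) [AddCommGroup N] [Module A N], PrecompSurj d N → PrecompInj d N →
      Subsingleton N) (hM : PrecompSurj d M) : Function.Surjective (traceMap d M) := by
  -- The quotient by the trace lies in both classes, so it vanishes.
  have := hz _ (hM.of_surjective (LinearMap.range (traceMap d M)).mkQ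
    (Submodule.mkQ_surjective _)) hd.precompInj_quotient_range_traceMap
  rw [← LinearMap.range_eq_top]
  exact Submodule.Quotient.subsingleton_iff.mp this

variable (d) in
/-- The differential, from degree `-1` to degree `0`, of the cocone of the universal morphism of
degree one from copies of the two-term complex `d` to a module `Q`. -/
def universalDiff (Q : Type u) [AddCommGroup Q] [Module A Q] :
    ((P₁ →ₗ[A] Q) →₀ P₁) →ₗ[A] ((P₁ →ₗ[A] Q) →₀ P₀) × Q :=
  (Finsupp.mapRange.linearMap d).prod (Finsupp.lsum ℕ fun u ↦ u)

lemma universalDiff_single (Q : Type u) [AddCommGroup Q] [Module A Q] (u : P₁ →ₗ[A] Q) (x : P₁) :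
    universalDiff d Q (Finsupp.single u x) = (Finsupp.single u (d x), u x) := by
  simp [universalDiff]

lemma universalDiff_apply_of_support {Q : Type u} [AddCommGroup Q] [Module A Q]
    (z : (P₁ →ₗ[A] Q) →₀ P₁) (s : Finset (P₁ →ₗ[A] Q)) (h : z.support ⊆ s) :
    (universalDiff d Q z).2 = ∑ u ∈ s, u (z u) := by
  simp only [universalDiff, LinearMap.prod_apply, Finsupp.coe_lsum]
  exact Finsupp.sum_of_support_subset z h _ (by simp)

lemma universalDiff_apply_fst {Q : Type u} [AddCommGroup Q] [Module A Q]
    (z : (P₁ →ₗ[A] Q) →₀ P₁) (u : P₁ →ₗ[A] Q) :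
    (universalDiff d Q z).1 u = d (z u) := by
  simp [universalDiff]

/-- The module is `H⁰` of the cocone `E`. An obstruction in `Hom(P, E[1])` comes from `Hom(P,
Q[1])`, because `P` is rigid, and the universal map kills everything there. -/
lemma IsRigid.precompSurj_universal [Module.Projective A P₁] [Module.Finite A P₁]
    (hd : IsRigid d) (Q : Type u) [AddCommGroup Q] [Module A Q] :
    PrecompSurj d ((((P₁ →ₗ[A] Q) →₀ P₀) × Q) ⧸ LinearMap.range (universalDiff d Q)) := by
  set π := (LinearMap.range (universalDiff d Q)).mkQ
  have hπ (u : P₁ →ₗ[A] Q) (x : P₁) : π (Finsupp.single u (d x), 0) = - π (0, u x) := by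
    rw [← map_neg, ← sub_eq_zero, ← map_sub, ← LinearMap.mem_ker, Submodule.ker_mkQ]
    exact ⟨Finsupp.single u x, by simp [universalDiff_single]⟩
  have hQ (u : P₁ →ₗ[A] Q) : ∃ g, g ∘ₗ d = π ∘ₗ LinearMap.inr A _ _ ∘ₗ u :=
    ⟨- (π ∘ₗ LinearMap.inl A _ _ ∘ₗ Finsupp.lsingle u), by
      ext x
      simp [hπ]⟩
  intro f
  obtain ⟨f', rfl⟩ := Module.projective_lifting_property π f (Submodule.mkQ_surjective _)
  obtain ⟨s, hs⟩ := exists_finset_support_le (LinearMap.fst A _ _ ∘ₗ f')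
  have key : π ∘ₗ f' = ∑ u ∈ s, (π ∘ₗ LinearMap.inl A _ _ ∘ₗ Finsupp.lsingle u ∘ₗ
      Finsupp.lapply u ∘ₗ LinearMap.fst A _ _ ∘ₗ f') +
        π ∘ₗ LinearMap.inr A _ _ ∘ₗ LinearMap.snd A _ _ ∘ₗ f' := by
    ext x
    have h1 : f' x = LinearMap.inl A _ _ ((f' x).1) + LinearMap.inr A _ _ ((f' x).2) := by simp
    conv_lhs => rw [LinearMap.comp_apply, h1,
      Finsupp.eq_sum_single (f' x).1 s (hs s subset_rfl x)]
    simp only [map_add, map_sum]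
    simp
  obtain ⟨g₁, hg₁⟩ := precompSurj_sum (d := d) s (fun u ↦ π ∘ₗ LinearMap.inl A _ _ ∘ₗ
      Finsupp.lsingle u ∘ₗ Finsupp.lapply u ∘ₗ LinearMap.fst A _ _ ∘ₗ f') (fun u _ ↦ by
    obtain ⟨h, k, hk⟩ := hd (Finsupp.lapply u ∘ₗ LinearMap.fst A _ _ ∘ₗ f')
    -- In copy `u` the term `d ∘ h` becomes `-(u ∘ h)` modulo the range: again a map into `Q`,
    -- absorbed by the copy indexed by `u ∘ h`.
    obtain ⟨g, hg⟩ := hQ (u ∘ₗ h)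
    refine ⟨π ∘ₗ LinearMap.inl A _ _ ∘ₗ Finsupp.lsingle u ∘ₗ k - g, ?_⟩
    rw [LinearMap.sub_comp, hg, hk]
    ext x
    have h1 : LinearMap.inl A ((P₁ →ₗ[A] Q) →₀ P₀) Q (Finsupp.single u (d (h x) + k (d x))) =
        (Finsupp.single u (d (h x)), 0) + LinearMap.inl A _ _ (Finsupp.single u (k (d x))) := by
      simp
    simp only [LinearMap.sub_apply, LinearMap.comp_apply, LinearMap.add_apply,
      Finsupp.lsingle_apply]
    rw [h1, map_add, hπ]
    simp [sub_eq_neg_add])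
  obtain ⟨g₂, hg₂⟩ := hQ (LinearMap.snd A _ _ ∘ₗ f')
  exact ⟨g₁ + g₂, by rw [key, LinearMap.add_comp, hg₁, hg₂]⟩

/-- The matrix form of the statement that the cone of some morphism from a finitely generated
projective module `Q` to copies of the two-term complex `d` is a retract of copies of `d`. -/
lemma IsRigid.exists_matrices [Module.Projective A P₁] [Module.Finite A P₁]
    [Module.Projective A P₀] [Module.Finite A P₀] (hd : IsRigid d)
    (hz : ∀ (N : Type u) [AddCommGroup N] [Module A N], PrecompSurj d N → PrecompInj d N →
      Subsingleton N)
    (Q : Type u) [AddCommGroup Q] [Module A Q] [Module.Projective A Q] [Module.Finite A Q] :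
    ∃ (ι κ : Type u) (_ : Fintype ι) (_ : Fintype κ) (x : ι → (Q →ₗ[A] P₀))
      (g₀ : ι → κ → (P₀ →ₗ[A] P₀)) (g₁ : ι → κ → (P₁ →ₗ[A] P₁)) (w : ι → (P₀ →ₗ[A] Q))
      (y : κ → (Q →ₗ[A] P₁)) (u : κ → (P₁ →ₗ[A] Q)),
      (∀ i k, g₀ i k ∘ₗ d = d ∘ₗ g₁ i k) ∧
      (∀ k, d ∘ₗ y k = ∑ i, g₀ i k ∘ₗ x i) ∧
      (∑ i, w i ∘ₗ x i = LinearMap.id + ∑ k, u k ∘ₗ y k) ∧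
      (∀ i, w i ∘ₗ d = ∑ k, u k ∘ₗ g₁ i k) := by
  classical
  set R := LinearMap.range (universalDiff d Q) with hR
  have hmem (z) : z ∈ R ↔ R.mkQ z = 0 := by rw [← LinearMap.mem_ker, Submodule.ker_mkQ]
  have hsurj := hd.traceMap_surjective hz (hd.precompSurj_universal Q)
  -- The canonical map `Q → H⁰(E)` lifts along the trace map, and only finitely many copies of `P₀`
  -- are involved.
  obtain ⟨ψ, hψ⟩ := Module.projective_lifting_property _
    (R.mkQ ∘ₗ LinearMap.inr A ((P₁ →ₗ[A] Q) →₀ P₀) Q) hsurj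
  obtain ⟨t, ht⟩ := exists_finset_support_le ψ
  have hG (g : {g : P₀ →ₗ[A] _ ⧸ R // g ∘ₗ d = 0}) :
      ∃ G : P₀ →ₗ[A] ((P₁ →ₗ[A] Q) →₀ P₀) × Q, R.mkQ ∘ₗ G = g.1 :=
    Module.projective_lifting_property R.mkQ g.1 (Submodule.mkQ_surjective _)
  choose G hG using hG
  -- The pair `(γ, G)` is a morphism of complexes `P → E` inducing `g` on `H⁰`.
  have hγ (g : {g : P₀ →ₗ[A] _ ⧸ R // g ∘ₗ d = 0}) :
      ∃ γ : P₁ →ₗ[A] ((P₁ →ₗ[A] Q) →₀ P₁), universalDiff d Q ∘ₗ γ = G g ∘ₗ d := by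
    refine exists_comp_eq_of_range_le _ _ fun v ↦ ?_
    rw [← hR, hmem, ← LinearMap.comp_apply,
      ← LinearMap.comp_assoc, hG, g.2, LinearMap.zero_apply]
  choose γ hγ using hγ
  -- `y` is a homotopy between the composite `Q → F → E` and the inclusion of `Q`.
  obtain ⟨y, hy⟩ : ∃ y : Q →ₗ[A] ((P₁ →ₗ[A] Q) →₀ P₁), universalDiff d Q ∘ₗ y =
      (∑ j : t, G j ∘ₗ Finsupp.lapply j.1 ∘ₗ ψ) - LinearMap.inr A _ _ := by
    refine exists_comp_eq_of_range_le _ _ fun v ↦ (hmem _).2 ?_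
    rw [LinearMap.sub_apply, map_sub,
      sub_eq_zero, ← LinearMap.comp_apply, ← LinearMap.comp_apply R.mkQ (LinearMap.inr A _ _),
      ← hψ, LinearMap.comp_apply, LinearMap.comp_apply,
      Finsupp.eq_sum_single (ψ v) t (ht t subset_rfl v), ← Finset.sum_coe_sort t]
    simp only [LinearMap.sum_apply, map_sum]
    refine Finset.sum_congr rfl fun j _ ↦ ?_
    rw [traceMap_single, ← hG]
    simp
  -- One finite set of copies in `E` supports `y` and all the `γ j`, so the infinite sums can be
  -- truncated. The four identities are the components of `hγ` and `hy` in these copies and in `Q`.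
  obtain ⟨s₀, hs₀⟩ := exists_finset_support_le y
  choose s₁ hs₁ using fun j ↦ exists_finset_support_le (γ j)
  let s := s₀ ∪ Finset.univ.biUnion fun j : t ↦ s₁ j.1
  have hy' (v) : (y v).support ⊆ s := hs₀ _ Finset.subset_union_left v
  have hγ' (j : t) (v) : (γ j v).support ⊆ s := hs₁ _ _
    ((Finset.subset_biUnion_of_mem (fun j : t ↦ s₁ j.1) (Finset.mem_univ j)).trans
      Finset.subset_union_right) v
  refine ⟨t, s, inferInstance, inferInstance, fun j ↦ Finsupp.lapply j.1 ∘ₗ ψ,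
    fun j k ↦ Finsupp.lapply k.1 ∘ₗ LinearMap.fst A _ _ ∘ₗ G j,
    fun j k ↦ Finsupp.lapply k.1 ∘ₗ γ j, fun j ↦ LinearMap.snd A _ _ ∘ₗ G j,
    fun k ↦ Finsupp.lapply k.1 ∘ₗ y, fun k ↦ k.1, fun j k ↦ ?_, fun k ↦ ?_, ?_, fun j ↦ ?_⟩
  · ext v
    have := LinearMap.congr_fun (hγ j.1) v
    simp only [LinearMap.comp_apply] at this
    simp [← this, universalDiff_apply_fst]
  · ext v
    have := LinearMap.congr_fun hy v
    simp only [LinearMap.comp_apply] at this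
    simp [← universalDiff_apply_fst, this, Finsupp.finsetSum_apply, Prod.fst_sum]
  · ext v
    have := LinearMap.congr_fun hy v
    simp only [LinearMap.comp_apply] at this
    have h2 := universalDiff_apply_of_support (d := d) (y v) s (hy' v)
    rw [this, ← Finset.sum_coe_sort s] at h2
    simp only [LinearMap.sum_apply, LinearMap.add_apply, LinearMap.comp_apply,
      Finsupp.lapply_apply]
    rw [← h2]
    simp [Prod.snd_sum]
  · ext v
    have := LinearMap.congr_fun (hγ j.1) v
    simp only [LinearMap.comp_apply] at this
    have h2 := universalDiff_apply_of_support (d := d) (γ j v) s (hγ' j v)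
    rw [this, ← Finset.sum_coe_sort s] at h2
    simp [h2]

end Modules

/-! ### Cokernel and kernel of the differential -/

section Modules

variable {A : Type u} [Ring A] {P₁ P₀ : Type u} [AddCommGroup P₁] [Module A P₁]
  [AddCommGroup P₀] [Module A P₀] {d : P₁ →ₗ[A] P₀} {H : Type u} [AddCommGroup H] [Module A H]

lemma precompSurj_coker_iff_isRigid [Module.Projective A P₁] [Module.Projective A P₀]
    (π : P₀ →ₗ[A] H) (hπ : Function.Surjective π) (hk : LinearMap.range d = LinearMap.ker π) :
    PrecompSurj d H ↔ IsRigid d := by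
  have hπd : π ∘ₗ d = 0 := LinearMap.range_le_ker_iff.mp hk.le
  constructor
  · intro hX f
    obtain ⟨g, hg⟩ := hX (π ∘ₗ f)
    obtain ⟨k, rfl⟩ := Module.projective_lifting_property π g hπ
    obtain ⟨h, hh⟩ := exists_comp_eq_of_range_le d (f - k ∘ₗ d) fun v ↦ by
      rw [hk, LinearMap.mem_ker, ← LinearMap.comp_apply, LinearMap.comp_sub,
        ← LinearMap.comp_assoc, hg, sub_self, LinearMap.zero_apply]
    exact ⟨h, k, by rw [hh, sub_add_cancel]⟩
  · intro hd f
    obtain ⟨f', rfl⟩ := Module.projective_lifting_property π f hπ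
    obtain ⟨h, k, hf⟩ := hd f'
    exact ⟨π ∘ₗ k, by rw [hf, LinearMap.comp_add, ← LinearMap.comp_assoc, hπd,
      LinearMap.zero_comp, zero_add, LinearMap.comp_assoc]⟩

lemma precompInj_ker_iff (ι : H →ₗ[A] P₁) (hι : Function.Injective ι)
    (hk : LinearMap.range ι = LinearMap.ker d) :
    PrecompInj d H ↔ ∀ f : P₀ →ₗ[A] P₁, d ∘ₗ f = 0 → f ∘ₗ d = 0 → f = 0 := by
  have hιd : d ∘ₗ ι = 0 := LinearMap.range_le_ker_iff.mp hk.le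
  constructor
  · intro hY f h₁ h₂
    let f' : P₀ →ₗ[A] H := (LinearEquiv.ofInjective ι hι).symm.toLinearMap ∘ₗ
      f.codRestrict (LinearMap.range ι) (fun v ↦ by
        rw [hk, LinearMap.mem_ker]; exact LinearMap.congr_fun h₁ v)
    have hf' (v) : ι (f' v) = f v :=
      congrArg Subtype.val ((LinearEquiv.ofInjective ι hι).apply_symm_apply _)
    have h0 := hY f' (by
      ext v
      apply hι
      simpa [hf'] using LinearMap.congr_fun h₂ v)
    ext v
    rw [← hf', h0]
    simp
  · intro hf g hg
    have := hf (ι ∘ₗ g) (by rw [← LinearMap.comp_assoc, hιd, LinearMap.zero_comp])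
      (by rw [LinearMap.comp_assoc, hg, LinearMap.comp_zero])
    ext v
    apply hι
    simpa using LinearMap.congr_fun this v

end Modules

/-! ### Morphisms in the homotopy and derived categories -/

section Hom

variable {C : Type u} [Category.{v} C] [Abelian C]

open CochainComplex.HomComplex

lemma subsingleton_hom_shift_iff (K L : CochainComplex C ℤ) (n : ℤ) :
    Subsingleton ((HomotopyCategory.quotient C (.up ℤ)).obj K ⟶
      ((HomotopyCategory.quotient C (.up ℤ)).obj L)⟦n⟧) ↔
    ∀ z : Cocycle K L n, z ∈ coboundaries K L n := by
  have e := (CohomologyClass.homAddEquiv (K := K) (L := L) (n := n)).toEquiv.trans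
    (((HomotopyCategory.quotient C (.up ℤ)).commShiftIso n).app L).homToEquiv
  refine (e.symm.subsingleton_congr).trans ⟨fun h z ↦ ?_, fun h ↦ ⟨fun x y ↦ ?_⟩⟩
  · rw [← CohomologyClass.mk_eq_zero_iff]
    exact Subsingleton.elim _ _
  · obtain ⟨x, rfl⟩ := x.mk_surjective
    obtain ⟨y, rfl⟩ := y.mk_surjective
    rw [(CohomologyClass.mk_eq_zero_iff x).2 (h x), (CohomologyClass.mk_eq_zero_iff y).2 (h y)]

lemma subsingleton_hom_shift_single_iff (K : CochainComplex C ℤ) (M : C) (n p' p p'' q : ℤ)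
    (h : p + n = q) (hp' : p' + 1 = p) (hp'' : p + 1 = p'') :
    Subsingleton ((HomotopyCategory.quotient C (.up ℤ)).obj K ⟶
      ((HomotopyCategory.quotient C (.up ℤ)).obj
        ((CochainComplex.singleFunctor C q).obj M))⟦n⟧) ↔
    ∀ f : K.X p ⟶ M, K.d p' p ≫ f = 0 → ∃ g : K.X p'' ⟶ M, K.d p p'' ≫ g = f := by
  rw [subsingleton_hom_shift_iff]
  constructor
  · intro H f hf
    exact (Cocycle.toSingleMk_mem_coboundaries_iff f h p' hp' hf p'' hp'').1 (H _)
  · intro H z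
    obtain ⟨f, hf, rfl⟩ := Cocycle.toSingleMk_surjective z p h p' hp'
    exact (Cocycle.toSingleMk_mem_coboundaries_iff f h p' hp' hf p'' hp'').2 (H f hf)

lemma subsingleton_derived_hom_shift_iff [HasDerivedCategory.{w} C] (K L : CochainComplex C ℤ)
    [K.IsKProjective] (n : ℤ) :
    Subsingleton (DerivedCategory.Q.obj K ⟶ (DerivedCategory.Q.obj L)⟦n⟧) ↔
      Subsingleton ((HomotopyCategory.quotient C (.up ℤ)).obj K ⟶
        ((HomotopyCategory.quotient C (.up ℤ)).obj L)⟦n⟧) := by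
  have e₁ := Equiv.ofBijective _ (CochainComplex.IsKProjective.Qh_map_bijective K
    (((HomotopyCategory.quotient C (.up ℤ)).obj L)⟦n⟧))
  have e₂ := Iso.homCongr ((DerivedCategory.quotientCompQhIso C).app K)
    ((DerivedCategory.Qh.commShiftIso n).app ((HomotopyCategory.quotient C (.up ℤ)).obj L) ≪≫
      (shiftFunctor _ n).mapIso ((DerivedCategory.quotientCompQhIso C).app L))
  exact (e₁.trans e₂).symm.subsingleton_congr

end Hom

/-! ### The classes and self-extensions of a two-term complex -/

section TwoTerm

variable {A : Type u} [Ring A] (P : CochainComplex (ModuleCat.{u} A) ℤ)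

lemma isKProjective_of_isStrictlyLE (b : ℤ) [P.IsStrictlyLE b]
    (hproj : ∀ i, Module.Projective A (P.X i)) : P.IsKProjective := by
  have (i : ℤ) : Projective (P.X i) := (IsProjective.iff_projective (P.X i)).1 (hproj i)
  exact CochainComplex.isKProjective_of_projective P b

lemma subsingleton_hom_shift_single_one_iff [P.IsStrictlyGE (-1)] (M : ModuleCat.{u} A) :
    Subsingleton (toK P ⟶ (toK ((CochainComplex.singleFunctor _ 0).obj M))⟦(1 : ℤ)⟧) ↔
      PrecompSurj (P.d (-1) 0).hom M := by
  rw [subsingleton_hom_shift_single_iff P M 1 (-2) (-1) 0 0 (by lia) (by lia) (by lia)]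
  have h0 : IsZero (P.X (-2)) := P.isZero_of_isStrictlyGE (-1) (-2)
  constructor
  · intro h f
    obtain ⟨g, hg⟩ := h (ModuleCat.ofHom f) (h0.eq_of_src _ _)
    exact ⟨g.hom, by simpa using congrArg ModuleCat.Hom.hom hg⟩
  · intro h f _
    obtain ⟨g, hg⟩ := h f.hom
    exact ⟨ModuleCat.ofHom g, by ext : 1; simpa using hg⟩

lemma subsingleton_hom_shift_single_zero_iff [P.IsStrictlyLE 0] (M : ModuleCat.{u} A) :
    Subsingleton (toK P ⟶ (toK ((CochainComplex.singleFunctor _ 0).obj M))⟦(0 : ℤ)⟧) ↔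
      PrecompInj (P.d (-1) 0).hom M := by
  rw [subsingleton_hom_shift_single_iff P M 0 (-1) 0 1 0 (by lia) (by lia) (by lia)]
  have h0 : IsZero (P.X 1) := P.isZero_of_isStrictlyLE 0 1
  constructor
  · intro h f hf
    obtain ⟨g, hg⟩ := h (ModuleCat.ofHom f) (by ext : 1; simpa using hf)
    rw [h0.eq_of_src g 0, comp_zero] at hg
    simpa using (congrArg ModuleCat.Hom.hom hg).symm
  · intro h f hf
    have := h f.hom (by simpa using congrArg ModuleCat.Hom.hom hf)
    exact ⟨0, by ext : 1; simp [this]⟩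

variable {P} in
lemma classY_iff [P.IsStrictlyLE 0] [HasDerivedCategory.{w} (ModuleCat.{u} A)]
    (hproj : ∀ i, Module.Projective A (P.X i)) (M : ModuleCat.{u} A) :
    classY P M ↔ PrecompInj (P.d (-1) 0).hom M := by
  have := isKProjective_of_isStrictlyLE P 0 hproj
  rw [← subsingleton_hom_shift_single_zero_iff]
  refine Iff.trans ?_
    (subsingleton_derived_hom_shift_iff P ((CochainComplex.singleFunctor _ 0).obj M) 0)
  exact (((shiftFunctorZero _ ℤ).app _).symm.homToEquiv).subsingleton_congr

lemma exists_presentation_homology_zero [P.IsStrictlyLE 0] :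
    ∃ π : P.X 0 →ₗ[A] P.homology 0, Function.Surjective π ∧
      LinearMap.range (P.d (-1) 0).hom = LinearMap.ker π := by
  have : IsIso (P.homologyι 0) := P.isIso_homologyι 0 1 (by simp)
    ((P.isZero_of_isStrictlyLE 0 1).eq_of_tgt _ _)
  have hex := ShortComplex.exact_of_g_is_cokernel
    (ShortComplex.mk _ _ (P.d_pOpcycles (-1) 0)) (P.opcyclesIsCokernel (-1) 0 (by simp))
  have hex' : (ShortComplex.mk (P.d (-1) 0) (P.pOpcycles 0 ≫ inv (P.homologyι 0))
      (by simp)).Exact := by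
    refine (ShortComplex.exact_iff_of_iso ?_).1 hex
    exact ShortComplex.isoMk (Iso.refl _) (Iso.refl _) (asIso (P.homologyι 0)).symm
      (by simp) (by simp)
  exact ⟨(P.pOpcycles 0 ≫ inv (P.homologyι 0)).hom,
    (ModuleCat.epi_iff_surjective _).1 inferInstance, hex'.moduleCat_range_eq_ker⟩

lemma precompSurj_homology_iff_isRigid [P.IsStrictlyLE 0]
    (hproj : ∀ i, Module.Projective A (P.X i)) :
    PrecompSurj (P.d (-1) 0).hom (P.homology 0) ↔ IsRigid (P.d (-1) 0).hom := by
  have := hproj 0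
  have := hproj (-1)
  obtain ⟨π, hπ, hk⟩ := exists_presentation_homology_zero P
  exact precompSurj_coker_iff_isRigid π hπ hk

lemma precompInj_homology_iff [P.IsStrictlyGE (-1)] :
    PrecompInj (P.d (-1) 0).hom (P.homology (-1)) ↔
      ∀ f : P.X 0 →ₗ[A] P.X (-1), (P.d (-1) 0).hom ∘ₗ f = 0 → f ∘ₗ (P.d (-1) 0).hom = 0 →
        f = 0 := by
  have : IsIso (P.homologyπ (-1)) := P.isIso_homologyπ (-2) (-1) (by simp)
    ((P.isZero_of_isStrictlyGE (-1) (-2)).eq_of_src _ _)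
  have hex := ShortComplex.exact_of_f_is_kernel
    (ShortComplex.mk _ _ (P.iCycles_d (-1) 0)) (P.cyclesIsKernel (-1) 0 (by simp))
  have hex' : (ShortComplex.mk (inv (P.homologyπ (-1)) ≫ P.iCycles (-1)) (P.d (-1) 0)
      (by simp)).Exact := by
    refine (ShortComplex.exact_iff_of_iso ?_).1 hex
    exact ShortComplex.isoMk (asIso (P.homologyπ (-1))) (Iso.refl _) (Iso.refl _)
      (by simp) (by simp)
  exact precompInj_ker_iff (inv (P.homologyπ (-1)) ≫ P.iCycles (-1)).hom
    ((ModuleCat.mono_iff_injective _).1 inferInstance) hex'.moduleCat_range_eq_ker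

variable [P.IsStrictlyGE (-1)] [P.IsStrictlyLE 0]

lemma subsingleton_hom_shift_single_of_ne (M : ModuleCat.{u} A) (n : ℤ) (h₀ : n ≠ 0)
    (h₁ : n ≠ 1) :
    Subsingleton (toK P ⟶ (toK ((CochainComplex.singleFunctor _ 0).obj M))⟦n⟧) := by
  rw [subsingleton_hom_shift_single_iff P M n (-n - 1) (-n) (-n + 1) 0 (by lia) (by lia) (by lia)]
  intro f _
  have h0 : IsZero (P.X (-n)) := by
    by_cases h : 0 < -n
    · exact P.isZero_of_isStrictlyLE 0 (-n)
    · exact P.isZero_of_isStrictlyGE (-1) (-n)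
  exact ⟨0, h0.eq_of_src _ _⟩

variable {P} in
lemma classX_iff [HasDerivedCategory.{w} (ModuleCat.{u} A)]
    (hproj : ∀ i, Module.Projective A (P.X i)) (M : ModuleCat.{u} A) :
    classX P M ↔ PrecompSurj (P.d (-1) 0).hom M := by
  have := isKProjective_of_isStrictlyLE P 0 hproj
  rw [← subsingleton_hom_shift_single_one_iff]
  exact subsingleton_derived_hom_shift_iff P ((CochainComplex.singleFunctor _ 0).obj M) 1

open CochainComplex.HomComplex

lemma subsingleton_hom_shift_one_iff_isRigid :
    Subsingleton (toK P ⟶ (toK P)⟦(1 : ℤ)⟧) ↔ IsRigid (P.d (-1) 0).hom := by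
  rw [subsingleton_hom_shift_iff]
  have h1 : IsZero (P.X 1) := P.isZero_of_isStrictlyLE 0 1
  constructor
  · intro H f
    let z : Cochain P P 1 := Cochain.single (p := -1) (q := 0) (ModuleCat.ofHom f) 1
    have hz : δ 1 2 z = 0 := by
      rw [Cochain.δ_single _ 1 2 (by lia) (-2) 1 (by lia) (by lia), h1.eq_of_tgt (P.d 0 1) 0,
        (P.isZero_of_isStrictlyGE (-1) (-2)).eq_of_src (P.d (-2) (-1)) 0]
      simp
    obtain ⟨β, hβ⟩ := (mem_coboundaries_iff _ 0 (by lia)).1 (H (Cocycle.mk z 2 (by lia) hz))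
    have := Cochain.congr_v hβ (-1) 0 (by lia)
    rw [δ_v 0 1 (by lia) β (-1) 0 (by lia) (-1) 0 (by lia) (by lia)] at this
    simp only [Cocycle.mk_coe, z, Cochain.single_v] at this
    -- In degree zero `δ` is a commutator with `d`, whence the sign on `k`.
    refine ⟨(β.v (-1) (-1) (by lia)).hom, - (β.v 0 0 (by lia)).hom, ?_⟩
    have h2 := congrArg ModuleCat.Hom.hom this
    simp at h2
    rw [← h2]
    ext; simp
  · intro hd z
    obtain ⟨h, k, hk⟩ := hd (z.1.v (-1) 0 (by lia)).hom
    rw [mem_coboundaries_iff _ 0 (by lia)]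
    refine ⟨Cochain.single (p := -1) (q := -1) (ModuleCat.ofHom h) 0 -
      Cochain.single (p := 0) (q := 0) (ModuleCat.ofHom k) 0, ?_⟩
    ext p q hpq : 1
    by_cases hp : p = -1
    · obtain rfl : q = 0 := by lia
      subst hp
      rw [δ_v 0 1 (by lia) _ (-1) 0 (by lia) (-1) 0 (by lia) (by lia)]
      ext : 1
      rw [hk]
      simp [Cochain.single_v, Cochain.single_v_eq_zero]
    · by_cases hp' : p < -1
      · exact (P.isZero_of_isStrictlyGE (-1) p).eq_of_src _ _
      · exact (P.isZero_of_isStrictlyLE 0 q).eq_of_tgt _ _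

/-- Cochains of degree `-2` on a two-term complex vanish, so no nonzero cocycle of degree `-1` is a
coboundary. -/
lemma subsingleton_hom_shift_neg_one_iff :
    Subsingleton (toK P ⟶ (toK P)⟦(-1 : ℤ)⟧) ↔
      ∀ f : P.X 0 →ₗ[A] P.X (-1), (P.d (-1) 0).hom ∘ₗ f = 0 → f ∘ₗ (P.d (-1) 0).hom = 0 →
        f = 0 := by
  rw [subsingleton_hom_shift_iff]
  constructor
  · intro H f h₁ h₂
    let z : Cochain P P (-1) := Cochain.single (p := 0) (q := -1) (ModuleCat.ofHom f) (-1)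
    have hz : δ (-1) 0 z = 0 := by
      rw [Cochain.δ_single _ (-1) 0 (by lia) (-1) 0 (by lia) (by lia),
        show ModuleCat.ofHom f ≫ P.d (-1) 0 = 0 by ext : 1; simpa using h₁,
        show P.d (-1) 0 ≫ ModuleCat.ofHom f = 0 by ext : 1; simpa using h₂]
      simp
    obtain ⟨β, hβ⟩ := (mem_coboundaries_iff _ (-2) (by lia)).1 (H (Cocycle.mk z 0 (by lia) hz))
    have hβ0 : β = 0 := by
      ext p q hpq : 1
      by_cases hp : p < 1
      · exact (P.isZero_of_isStrictlyGE (-1) q).eq_of_tgt _ _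
      · exact (P.isZero_of_isStrictlyLE 0 p).eq_of_src _ _
    have := Cochain.congr_v hβ 0 (-1) (by lia)
    rw [hβ0] at this
    simp only [δ_zero, Cocycle.mk_coe, z, Cochain.single_v, Cochain.zero_v] at this
    simpa using (congrArg ModuleCat.Hom.hom this).symm
  · intro H z
    have hz : z = 0 := by
      ext p q hpq : 2
      have hd := z.δ_eq_zero 0
      by_cases hp : p = 0
      · obtain rfl : q = -1 := by lia
        subst hp
        have e₁ := Cochain.congr_v hd 0 0 (by lia)
        have e₂ := Cochain.congr_v hd (-1) (-1) (by lia)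
        rw [δ_v (-1) 0 (by lia) _ 0 0 (by lia) (-1) 1 (by lia) (by lia),
          (P.isZero_of_isStrictlyLE 0 1).eq_of_tgt (P.d 0 1) 0] at e₁
        rw [δ_v (-1) 0 (by lia) _ (-1) (-1) (by lia) (-2) 0 (by lia) (by lia),
          (P.isZero_of_isStrictlyGE (-1) (-2)).eq_of_src (P.d (-2) (-1)) 0] at e₂
        ext : 1
        exact H _ (by simpa using congrArg ModuleCat.Hom.hom e₁)
          (by simpa using congrArg ModuleCat.Hom.hom e₂)
      · by_cases hp' : p < 0
        · exact (P.isZero_of_isStrictlyGE (-1) q).eq_of_tgt _ _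
        · exact (P.isZero_of_isStrictlyLE 0 p).eq_of_src _ _
    rw [hz]
    exact zero_mem _

lemma subsingleton_hom_shift_of_ne (n : ℤ) (h₀ : n ≠ 0) (h₁ : n ≠ 1) (h₂ : n ≠ -1) :
    Subsingleton (toK P ⟶ (toK P)⟦n⟧) := by
  rw [subsingleton_hom_shift_iff]
  intro z
  have hz : z = 0 := by
    ext p q hpq : 2
    by_cases hp : p < -1
    · exact (P.isZero_of_isStrictlyGE (-1) p).eq_of_src _ _
    by_cases hp : 0 < p
    · exact (P.isZero_of_isStrictlyLE 0 p).eq_of_src _ _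
    by_cases hp : q < -1
    · exact (P.isZero_of_isStrictlyGE (-1) q).eq_of_tgt _ _
    · exact (P.isZero_of_isStrictlyLE 0 q).eq_of_tgt _ _
  rw [hz]
  exact zero_mem _

end TwoTerm

/-! ### Reduction of bounded complexes to single modules -/

section Bounded

variable {A : Type u} [Ring A]

variable (K : CochainComplex (ModuleCat.{u} A) ℤ) (b : ℤ)

/-- The submodule of the term of degree `i` of a complex which is everything for `i = b`, and zero
otherwise. -/
def degreeSubmodule (i : ℤ) : Submodule A (K.X i) := if i = b then ⊤ else ⊥

variable {b} (hb : ∀ j, K.d b j = 0)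

include hb in
lemma degreeSubmodule_le_comap (i j : ℤ) :
    degreeSubmodule K b i ≤ (degreeSubmodule K b j).comap (K.d i j).hom := by
  by_cases hi : i = b
  · subst hi
    intro x _
    simp [hb]
  · simp [degreeSubmodule, hi]

/-- The quotient of a complex `K` by its term of degree `b`, when the differential from this term
vanishes. -/
def quotientDegree : CochainComplex (ModuleCat.{u} A) ℤ where
  X i := ModuleCat.of A (K.X i ⧸ degreeSubmodule K b i)
  d i j := ModuleCat.ofHom (Submodule.mapQ _ _ (K.d i j).hom (degreeSubmodule_le_comap K hb i j))
  shape i j hij := by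
    ext x
    simp [K.shape i j hij]
  d_comp_d' i j k _ _ := by
    ext x
    have := ConcreteCategory.congr_hom (K.d_comp_d i j k) x
    simp only [ConcreteCategory.comp_apply] at this
    simp [this]

lemma quotientDegree_X_isZero : IsZero ((quotientDegree K hb).X b) := by
  have : Subsingleton (K.X b ⧸ degreeSubmodule K b b) := by
    rw [Submodule.Quotient.subsingleton_iff]
    simp [degreeSubmodule]
  exact ModuleCat.isZero_of_iff_subsingleton.2 this

/-- The short complex given by the term of degree `b` of a complex, as a subcomplex. -/
def degreeShortComplex : ShortComplex (CochainComplex (ModuleCat.{u} A) ℤ) where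
  X₁ := (HomologicalComplex.single _ (.up ℤ) b).obj (K.X b)
  X₂ := K
  X₃ := quotientDegree K hb
  f := HomologicalComplex.mkHomFromSingle (𝟙 _) (by simp [hb])
  g :=
    { f := fun i ↦ ModuleCat.ofHom (degreeSubmodule K b i).mkQ
      comm' := fun i j _ ↦ rfl }
  zero := HomologicalComplex.from_single_hom_ext
    ((quotientDegree_X_isZero K hb).eq_of_tgt _ _)

lemma degreeShortComplex_g_bijective (i : ℤ) (hi : i ≠ b) :
    Function.Bijective ((degreeShortComplex K hb).g.f i) := by
  refine ⟨?_, Submodule.mkQ_surjective _⟩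
  change Function.Injective (degreeSubmodule K b i).mkQ
  rw [← LinearMap.ker_eq_bot, Submodule.ker_mkQ]
  simp [degreeSubmodule, hi]

lemma degreeShortComplex_shortExact (i : ℤ) :
    ((degreeShortComplex K hb).map (HomologicalComplex.eval _ _ i)).ShortExact := by
  by_cases hi : i = b
  · subst hi
    have h0 := quotientDegree_X_isZero K hb
    have hf : IsIso ((degreeShortComplex K hb).f.f i) := by
      dsimp [degreeShortComplex]
      rw [HomologicalComplex.mkHomFromSingle_f]
      infer_instance
    exact
      { exact := (ShortComplex.exact_iff_epi _ (h0.eq_of_tgt _ _)).2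
          (inferInstanceAs (Epi ((degreeShortComplex K hb).f.f i)))
        mono_f := inferInstanceAs (Mono ((degreeShortComplex K hb).f.f i))
        epi_g := h0.epi _ }
  · have h0 : IsZero ((degreeShortComplex K hb).X₁.X i) :=
      HomologicalComplex.isZero_single_obj_X _ _ _ _ hi
    have hg := degreeShortComplex_g_bijective K hb i hi
    exact
      { exact := (ShortComplex.exact_iff_mono _ (h0.eq_of_src _ _)).2
          ((ModuleCat.mono_iff_injective _).2 hg.1)
        mono_f := h0.mono _
        epi_g := (ModuleCat.epi_iff_surjective _).2 hg.2 }

variable {K} in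
lemma IsBoundedProj.quotientDegree (hK : IsBoundedProj K) :
    IsBoundedProj (quotientDegree K hb) where
  bounded := by
    obtain ⟨p, q, _, _⟩ := hK.bounded
    refine ⟨p, q, ?_, ?_⟩
    · rw [CochainComplex.isStrictlyGE_iff]
      intro i hi
      have := ModuleCat.subsingleton_of_isZero (K.isZero_of_isStrictlyGE p i hi)
      exact ModuleCat.isZero_of_iff_subsingleton.2
        (inferInstanceAs (Subsingleton (K.X i ⧸ degreeSubmodule K b i)))
    · rw [CochainComplex.isStrictlyLE_iff]
      intro i hi
      have := ModuleCat.subsingleton_of_isZero (K.isZero_of_isStrictlyLE q i hi)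
      exact ModuleCat.isZero_of_iff_subsingleton.2
        (inferInstanceAs (Subsingleton (K.X i ⧸ degreeSubmodule K b i)))
  finite i := by
    have := hK.finite i
    exact inferInstanceAs (Module.Finite A (K.X i ⧸ degreeSubmodule K b i))
  projective i := by
    by_cases hi : i = b
    · subst hi
      have := ModuleCat.subsingleton_of_isZero (quotientDegree_X_isZero K hb)
      infer_instance
    · have := hK.projective i
      let e : K.X i ≃ₗ[A] (TwoTermTilting.quotientDegree K hb).X i :=
        LinearEquiv.ofBijective ((degreeShortComplex K hb).g.f i).hom
          (degreeShortComplex_g_bijective K hb i hi)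
      exact Module.Projective.of_equiv e

/-- A triangulated subcategory of the homotopy category which contains all finitely generated
projective modules, in every degree, contains all bounded complexes of such modules. -/
lemma prop_toK_of_isBoundedProj
    (S : ObjectProperty (HomotopyCategory (ModuleCat.{u} A) (ComplexShape.up ℤ)))
    [S.IsTriangulated] [S.IsClosedUnderIsomorphisms]
    (hS : ∀ (b : ℤ) (Q : ModuleCat.{u} A), Module.Finite A Q → Module.Projective A Q →
      S (toK ((HomologicalComplex.single _ (.up ℤ) b).obj Q)))
    (K : CochainComplex (ModuleCat.{u} A) ℤ) (hK : IsBoundedProj K) : S (toK K) := by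
  obtain ⟨p, q, hp, hq⟩ := hK.bounded
  -- `n` bounds the number of nonzero terms; each step removes the top degree `q`, where the
  -- outgoing differential vanishes.
  obtain ⟨n, hn⟩ : ∃ n : ℕ, q < p + n := ⟨(q + 1 - p).toNat, by lia⟩
  induction n generalizing K q with
  | zero =>
    have h0 : IsZero K := by
      rw [IsZero.iff_id_eq_zero]
      ext i : 1
      by_cases hi : i < p
      · exact (K.isZero_of_isStrictlyGE p i hi).eq_of_src _ _
      · exact (K.isZero_of_isStrictlyLE q i).eq_of_src _ _
    exact S.prop_of_isZero ((HomotopyCategory.quotient _ _).map_isZero h0)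
  | succ n ih =>
    have hd (j : ℤ) : K.d q j = 0 := by
      by_cases h : q + 1 = j
      · exact (K.isZero_of_isStrictlyLE q j).eq_of_tgt _ _
      · exact K.shape _ _ h
    have hK' := hK.quotientDegree hd
    have hproj (i : ℤ) : Projective ((quotientDegree K hd).X i) :=
      (IsProjective.iff_projective ((quotientDegree K hd).X i)).1 (hK'.projective i)
    have hGE : (quotientDegree K hd).IsStrictlyGE p := by
      rw [CochainComplex.isStrictlyGE_iff]
      intro i hi
      have := ModuleCat.subsingleton_of_isZero (K.isZero_of_isStrictlyGE p i hi)
      exact ModuleCat.isZero_of_iff_subsingleton.2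
        (inferInstanceAs (Subsingleton (K.X i ⧸ degreeSubmodule K q i)))
    have hLE : (quotientDegree K hd).IsStrictlyLE (q - 1) := by
      rw [CochainComplex.isStrictlyLE_iff]
      intro i hi
      by_cases hi' : i = q
      · subst hi'
        exact quotientDegree_X_isZero K hd
      · have := ModuleCat.subsingleton_of_isZero (K.isZero_of_isStrictlyLE q i)
        exact ModuleCat.isZero_of_iff_subsingleton.2
          (inferInstanceAs (Subsingleton (K.X i ⧸ degreeSubmodule K q i)))
    -- Projectivity of the quotient terms splits the sequence degreewise, which gives a
    -- distinguished triangle.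
    have hT := (HomotopyCategory.distinguished_iff_iso_trianglehOfDegreewiseSplit _).2
      ⟨degreeShortComplex K hd,
        fun i ↦
          have : Projective ((degreeShortComplex K hd).map (HomologicalComplex.eval _ _ i)).X₃ :=
            hproj i
          (degreeShortComplex_shortExact K hd i).splittingOfProjective, ⟨Iso.refl _⟩⟩
    exact S.ext_of_isTriangulatedClosed₂ _ hT (hS q (K.X q) (hK.finite q) (hK.projective q))
      (ih _ hK' (q - 1) hGE hLE (by lia))

end Bounded

/-! ### Summands of copies of a rigid object -/

section Triangulated

open Pretriangulated

variable {C : Type u} [Category.{v} C] [HasZeroObject C] [HasShift C ℤ] [Preadditive C]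
  [∀ n : ℤ, (shiftFunctor C n).Additive] [Pretriangulated C]

/-- If the first two objects of a distinguished triangle are `X` and a retract `F` of copies of a
rigid object `T`, and if the connecting morphism factors through copies of `T`, then the third
object is a retract of copies of `T`. -/
lemma exists_sum_eq_id_of_distinguished {T X F D : C} {f : X ⟶ F} {g : F ⟶ D} {h : D ⟶ X⟦(1 : ℤ)⟧}
    (hT : Triangle.mk f g h ∈ distTriang C) (hrigid : Subsingleton (T ⟶ T⟦(1 : ℤ)⟧))
    {ι κ : Type w} [Fintype ι] [Fintype κ] (a : ι → (F ⟶ T)) (b : ι → (T ⟶ F))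
    (hab : ∑ i, a i ≫ b i = 𝟙 F) (v : κ → (D ⟶ T)) (t : κ → (T ⟶ X⟦(1 : ℤ)⟧))
    (hvt : h = ∑ k, v k ≫ t k) :
    ∃ (a' : ι ⊕ κ → (D ⟶ T)) (b' : ι ⊕ κ → (T ⟶ D)), ∑ j, a' j ≫ b' j = 𝟙 D := by
  -- Rigidity passes to the retract `F`, so every map `T ⟶ X⟦1⟧` lifts along `h`.
  have hF (s : T ⟶ F⟦(1 : ℤ)⟧) : s = 0 := by
    have h1 : s = s ≫ (shiftFunctor C (1 : ℤ)).map (𝟙 F) := by simp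
    rw [h1, ← hab, Functor.map_sum, Preadditive.comp_sum]
    refine Finset.sum_eq_zero fun i _ ↦ ?_
    rw [Functor.map_comp, ← Category.assoc,
      Subsingleton.elim (s ≫ (shiftFunctor C (1 : ℤ)).map (a i)) 0, zero_comp]
  have hlift (k : κ) : ∃ s : T ⟶ D, t k = s ≫ h :=
    Triangle.coyoneda_exact₁ _ hT (t k) (hF _)
  choose s hs using hlift
  -- Subtracting the lifted factorization from the identity gives a map killed by `h`, hence one
  -- through `F`.
  obtain ⟨r, hr⟩ : ∃ r : D ⟶ F, 𝟙 D - ∑ k, v k ≫ s k = r ≫ g :=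
    Triangle.coyoneda_exact₃ _ hT _ (by
      change (𝟙 D - ∑ k, v k ≫ s k) ≫ h = 0
      rw [Preadditive.sub_comp, Category.id_comp, Preadditive.sum_comp, sub_eq_zero]
      conv_lhs => rw [hvt]
      exact Finset.sum_congr rfl fun k _ ↦ by rw [hs, Category.assoc])
  refine ⟨Sum.elim (fun i ↦ r ≫ a i) v, Sum.elim (fun i ↦ b i ≫ g) s, ?_⟩
  rw [Fintype.sum_sum_type]
  have h2 : ∑ i, (r ≫ a i) ≫ b i ≫ g = r ≫ g := by
    simp only [Category.assoc]
    rw [← Preadditive.comp_sum]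
    simp only [← Category.assoc]
    rw [← Preadditive.sum_comp, hab, Category.id_comp]
  simp only [Sum.elim_inl, Sum.elim_inr]
  rw [h2, ← hr, sub_add_cancel]

end Triangulated

/-! ### Membership in `add(T)` -/

section AddClosure

variable {A : Type u} [Ring A] (T : CochainComplex (ModuleCat.{u} A) ℤ)

/-- The two families are the components of a retraction from a power of `T`, a biproduct of
complexes that the additive quotient functor preserves. -/
lemma addClosure_of_sum_eq_id {D : HomotopyCategory (ModuleCat.{u} A) (ComplexShape.up ℤ)}
    {ι : Type v} [Fintype ι] (a : ι → (D ⟶ toK T)) (b : ι → (toK T ⟶ D))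
    (hab : ∑ i, a i ≫ b i = 𝟙 D) : addClosure T D := by
  have : HasFiniteBiproducts (CochainComplex (ModuleCat.{u} A) ℤ) :=
    HasFiniteBiproducts.of_hasFiniteProducts
  let e := Fintype.equivFin ι
  let B := (biproduct.bicone (fun _ : Fin (Fintype.card ι) ↦ T))
  refine ⟨Fintype.card ι, (HomotopyCategory.quotient (ModuleCat.{u} A)
    (ComplexShape.up ℤ)).mapBicone B,
    ⟨isBilimitOfPreserves _ (biproduct.isBilimit _)⟩, ⟨?_⟩⟩
  let B' := (HomotopyCategory.quotient (ModuleCat.{u} A) (ComplexShape.up ℤ)).mapBicone B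
  refine { i := ∑ j, a (e.symm j) ≫ B'.ι j, r := ∑ j, B'.π j ≫ b (e.symm j), retract := ?_ }
  rw [← hab, Preadditive.sum_comp, ← e.symm.sum_comp (fun i ↦ a i ≫ b i)]
  refine Finset.sum_congr rfl fun i _ ↦ ?_
  rw [Preadditive.comp_sum, Finset.sum_eq_single i]
  · rw [Category.assoc]
    have := bicone_ι_π_self B' i
    rw [reassoc_of% this]
  · intro j _ hj
    have := bicone_ι_π_ne B' hj.symm
    rw [Category.assoc, reassoc_of% this, zero_comp, comp_zero]
  · simp

lemma leftOrthogonal_of_addClosure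
    (R : ObjectProperty (HomotopyCategory (ModuleCat.{u} A) (ComplexShape.up ℤ)))
    (hT : R.leftOrthogonal (toK T)) : addClosure T ≤ R.leftOrthogonal := by
  rintro D ⟨n, B, ⟨hB⟩, ⟨r⟩⟩ Y f hY
  have h0 : r.r ≫ f = 0 := hB.isColimit.hom_ext fun ⟨j⟩ ↦ by
    exact (hT (B.ι j ≫ r.r ≫ f) hY).trans comp_zero.symm
  rw [← Category.id_comp f, ← r.retract, Category.assoc, h0, comp_zero]

end AddClosure

/-- Finite direct powers in a preadditive category. -/
lemma exists_power {C : Type u} [Category.{v} C] [Preadditive C] [HasFiniteBiproducts C]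
    (P : C) (ι : Type w) [Fintype ι] :
    ∃ (F : C) (p : ι → (F ⟶ P)) (j : ι → (P ⟶ F)), ∑ i, p i ≫ j i = 𝟙 F ∧
      ∀ (X : C) (f : ι → (X ⟶ P)), ∃ φ : X ⟶ F, ∀ i, φ ≫ p i = f i := by
  let e := Fintype.equivFin ι
  refine ⟨⨁ fun _ : Fin (Fintype.card ι) ↦ P, fun i ↦ biproduct.π _ (e i),
    fun i ↦ biproduct.ι (fun _ : Fin (Fintype.card ι) ↦ P) (e i), ?_,
    fun _ f ↦ ⟨biproduct.lift fun l ↦ f (e.symm l), fun i ↦ by simp⟩⟩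
  rw [e.sum_comp fun l ↦ biproduct.π _ l ≫ biproduct.ι (fun _ : Fin (Fintype.card ι) ↦ P) l]
  exact biproduct.total

/-! ### The cone of a map from a module to copies of `P` -/

section Cone

open CochainComplex CochainComplex.HomComplex Pretriangulated

variable {A : Type u} [Ring A]

lemma fromSingleMk_comp_toSingleMk {Q : ModuleCat.{u} A} {K : CochainComplex (ModuleCat.{u} A) ℤ}
    {q n n' : ℤ} (f : Q ⟶ K.X q) (h : 0 + n = q) (g : K.X q ⟶ Q) (h' : q + n' = 0)
    (hn : n + n' = 0) :
    (Cochain.fromSingleMk f h).comp (Cochain.toSingleMk g h') hn =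
      Cochain.ofHom ((singleFunctor _ 0).map (f ≫ g)) := by
  have aux {X : ModuleCat.{u} A} (e : X ≅ Q) :
      e.inv ≫ ((e.hom ≫ f) ≫ g ≫ e.inv) ≫ e.hom = f ≫ g := by simp
  apply (Cochain.toSingleEquiv (add_zero 0)).injective
  refine (cancel_epi (HomologicalComplex.singleObjXSelf (.up ℤ) 0 Q).inv).1 ?_
  change (HomologicalComplex.singleObjXSelf (.up ℤ) 0 Q).inv ≫
    ((Cochain.fromSingleMk f h).comp (Cochain.toSingleMk g h') hn).v 0 0 (add_zero 0) ≫
      (HomologicalComplex.singleObjXSelf (.up ℤ) 0 Q).hom =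
    (HomologicalComplex.singleObjXSelf (.up ℤ) 0 Q).inv ≫
      (Cochain.ofHom ((singleFunctor _ 0).map (f ≫ g))).v 0 0 (add_zero 0) ≫
      (HomologicalComplex.singleObjXSelf (.up ℤ) 0 Q).hom
  rw [Cochain.comp_v _ _ hn 0 q 0 h h', Cochain.fromSingleMk_v, Cochain.toSingleMk_v,
    Cochain.ofHom_v]
  change _ = _ ≫ ((HomologicalComplex.single _ _ 0).map (f ≫ g)).f 0 ≫ _
  rw [HomologicalComplex.single_map_f_self]
  refine (aux _).trans ?_
  simp

lemma cochain_comp_sum {F G K : CochainComplex (ModuleCat.{u} A) ℤ} {κ : Type*} (s : Finset κ)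
    {n₁ n₂ n₁₂ : ℤ} (z₁ : Cochain F G n₁) (z₂ : κ → Cochain G K n₂) (h : n₁ + n₂ = n₁₂) :
    z₁.comp (∑ k ∈ s, z₂ k) h = ∑ k ∈ s, z₁.comp (z₂ k) h := by
  classical
  induction s using Finset.induction_on with
  | empty => simp
  | insert k s hk ih => simp [Finset.sum_insert hk, ih]

lemma cocycle_coe_sum {F G : CochainComplex (ModuleCat.{u} A) ℤ} {κ : Type*} (s : Finset κ)
    {n : ℤ} (z : κ → Cocycle F G n) :
    ((∑ k ∈ s, z k : Cocycle F G n) : Cochain F G n) = ∑ k ∈ s, (z k : Cochain F G n) :=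
  map_sum (Cocycle.toCochainAddMonoidHom F G n) z s

lemma cochain_ofHom_sum {F G : CochainComplex (ModuleCat.{u} A) ℤ} {κ : Type*} (s : Finset κ)
    (f : κ → (F ⟶ G)) : Cochain.ofHom (∑ k ∈ s, f k) = ∑ k ∈ s, Cochain.ofHom (f k) := by
  classical
  induction s using Finset.induction_on with
  | empty => simp
  | insert k s hk ih => simp [Finset.sum_insert hk, ih]

lemma cochain_δ_sum {F G : CochainComplex (ModuleCat.{u} A) ℤ} {κ : Type*} (s : Finset κ)
    (n m : ℤ) (z : κ → Cochain F G n) : δ n m (∑ k ∈ s, z k) = ∑ k ∈ s, δ n m (z k) := by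
  classical
  induction s using Finset.induction_on with
  | empty => simp
  | insert k s hk ih => simp [Finset.sum_insert hk, ih]

/-- The connecting morphism of the cone is `-fst`, so this factors it through the `v k` up to
homotopy. The homotopy is zero on `Q` and `-W` on `F`; `h₁` and `h₂` are its two components. -/
lemma fst_add_sum_mem_coboundaries {P : CochainComplex (ModuleCat.{u} A) ℤ} {Q : ModuleCat.{u} A}
    {F : CochainComplex (ModuleCat.{u} A) ℤ}
    {κ : Type u} [Fintype κ] (φ : (singleFunctor _ 0).obj Q ⟶ F)
    (v : κ → (mappingCone φ ⟶ P)) (u : κ → Cocycle P ((singleFunctor _ 0).obj Q) 1)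
    (W : Cochain F ((singleFunctor _ 0).obj Q) 0)
    (h₁ : (Cochain.ofHom φ).comp W (add_zero 0) = Cochain.ofHom (𝟙 _) +
      ∑ k, ((mappingCone.inl φ).comp (Cochain.ofHom (v k)) (add_zero (-1))).comp (u k).1
        (by lia : -1 + 1 = 0))
    (h₂ : δ 0 1 W = - ∑ k, (Cochain.ofHom (mappingCone.inr φ ≫ v k)).comp (u k).1 (zero_add 1)) :
    mappingCone.fst φ + ∑ k, (u k).precomp (v k) ∈ coboundaries _ _ _ := by
  rw [mem_coboundaries_iff _ 0 (by lia)]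
  refine ⟨mappingCone.descCochain φ (0 : Cochain _ _ (-1)) (-W) (by lia), ?_⟩
  rw [mappingCone.δ_descCochain φ (0 : Cochain _ _ (-1)) (-W) (by lia) 1 (by lia)]
  have e₁ : (mappingCone.inl φ).comp
      ((mappingCone.fst φ + ∑ k, (u k).precomp (v k) : Cocycle _ _ 1) : Cochain _ _ 1)
        (by lia : -1 + 1 = 0) = (Cochain.ofHom φ).comp W (add_zero 0) := by
    rw [h₁]
    simp [cocycle_coe_sum, cochain_comp_sum]
  have e₂ : (Cochain.ofHom (mappingCone.inr φ)).comp
      ((mappingCone.fst φ + ∑ k, (u k).precomp (v k) : Cocycle _ _ 1) : Cochain _ _ 1)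
        (zero_add 1) = - δ 0 1 W := by
    rw [h₂]
    simp [cocycle_coe_sum, cochain_comp_sum]
  rw [mappingCone.ext_cochain_from_iff φ 0 1 (by lia)]
  constructor
  · rw [e₁]
    simp
  · rw [e₂]
    simp

variable (P : CochainComplex (ModuleCat.{u} A) ℤ)
  [P.IsStrictlyGE (-1)] [P.IsStrictlyLE 0]

/-- A commutative square gives an endomorphism of a two-term complex. -/
lemma exists_endomorphism (g₀ : P.X 0 ⟶ P.X 0) (g₁ : P.X (-1) ⟶ P.X (-1))
    (h : P.d (-1) 0 ≫ g₀ = g₁ ≫ P.d (-1) 0) :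
    ∃ g : P ⟶ P, g.f 0 = g₀ ∧ g.f (-1) = g₁ := by
  let z : Cochain P P 0 := Cochain.single (p := 0) (q := 0) g₀ 0 +
    Cochain.single (p := -1) (q := -1) g₁ 0
  have hz₀ : z.v 0 0 (by lia) = g₀ := by
    simp [z, Cochain.single_v, Cochain.single_v_eq_zero]
  have hz₁ : z.v (-1) (-1) (by lia) = g₁ := by
    simp [z, Cochain.single_v, Cochain.single_v_eq_zero]
  have hz : δ 0 1 z = 0 := by
    ext p q hpq : 1
    by_cases hp : p = -1
    · obtain rfl : q = 0 := by lia
      subst hp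
      rw [δ_v 0 1 (by lia) _ (-1) 0 (by lia) (-1) 0 (by lia) (by lia), hz₀, hz₁]
      simp [h]
    · by_cases hp' : p < -1
      · exact (P.isZero_of_isStrictlyGE (-1) p).eq_of_src _ _
      · exact (P.isZero_of_isStrictlyLE 0 q).eq_of_tgt _ _
  refine ⟨Cocycle.homOf (Cocycle.mk z 1 (by lia) hz), ?_, ?_⟩
  · simpa using hz₀
  · simpa using hz₁

variable {P}

/-- A triangulated subcategory which contains `add P` contains a module `Q`, if there are matrices
as in `IsRigid.exists_matrices`. -/
lemma prop_single_of_matrices (Q : ModuleCat.{u} A) {ι κ : Type u} [Fintype ι] [Fintype κ]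
    (x : ι → (Q ⟶ P.X 0)) (g₀ : ι → κ → (P.X 0 ⟶ P.X 0)) (g₁ : ι → κ → (P.X (-1) ⟶ P.X (-1)))
    (w : ι → (P.X 0 ⟶ Q)) (y : κ → (Q ⟶ P.X (-1))) (u : κ → (P.X (-1) ⟶ Q))
    (hg : ∀ i k, P.d (-1) 0 ≫ g₀ i k = g₁ i k ≫ P.d (-1) 0)
    (hy : ∀ k, y k ≫ P.d (-1) 0 = ∑ i, x i ≫ g₀ i k)
    (hw : ∑ i, x i ≫ w i = 𝟙 Q + ∑ k, y k ≫ u k)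
    (hu : ∀ i, P.d (-1) 0 ≫ w i = ∑ k, g₁ i k ≫ u k)
    (hrigid : Subsingleton (toK P ⟶ (toK P)⟦(1 : ℤ)⟧))
    (S : ObjectProperty (HomotopyCategory (ModuleCat.{u} A) (ComplexShape.up ℤ)))
    [S.IsTriangulated] [S.IsClosedUnderIsomorphisms] (hS : addClosure P ≤ S) :
    S (toK ((singleFunctor _ 0).obj Q)) := by
  have : HasFiniteBiproducts (CochainComplex (ModuleCat.{u} A) ℤ) :=
    HasFiniteBiproducts.of_hasFiniteProducts
  choose g hg₀ hg₁ using fun i k ↦ exists_endomorphism P (g₀ i k) (g₁ i k) (hg i k)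
  let φ' (i : ι) : (singleFunctor _ 0).obj Q ⟶ P :=
    Cocycle.homOf (Cocycle.fromSingleMk (x i) (add_zero 0) 1 (by lia)
      ((P.isZero_of_isStrictlyLE 0 1).eq_of_tgt _ _))
  have hφ' (i : ι) : Cochain.ofHom (φ' i) = Cochain.fromSingleMk (x i) (add_zero 0) := by
    simp [φ']
  obtain ⟨F, p, j, hpj, hF⟩ := exists_power P ι
  obtain ⟨φ, hφ⟩ := hF _ φ'
  let G (k : κ) : F ⟶ P := ∑ i, p i ≫ g i k
  -- The homotopy `y k` kills `φ ≫ G k`, so `G k` extends to the cone as `V k`.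
  let α (k : κ) : Cochain ((singleFunctor _ 0).obj Q) P (-1) :=
    Cochain.fromSingleMk (y k) (by lia : 0 + -1 = -1)
  have hα (k : κ) : δ (-1) 0 (α k) = Cochain.ofHom (φ ≫ G k) := by
    have hG : φ ≫ G k = ∑ i, φ' i ≫ g i k := by
      dsimp only [G]
      rw [Preadditive.comp_sum]
      exact Finset.sum_congr rfl fun i _ ↦ by rw [← Category.assoc, hφ]
    dsimp only [α]
    rw [Cochain.δ_fromSingleMk _ _ 0 0 (by lia), hy, hG, cochain_ofHom_sum]
    trans ∑ i, Cochain.fromSingleMk (x i ≫ g₀ i k) (add_zero 0)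
    · exact map_sum (Cochain.fromSingleEquiv (add_zero 0)).symm _ _
    · refine Finset.sum_congr rfl fun i _ ↦ ?_
      rw [Cochain.ofHom_comp, hφ', ← hg₀, Cochain.fromSingleMk_postcomp]
  let V (k : κ) : mappingCone φ ⟶ P := mappingCone.desc φ (α k) (G k) (hα k)
  let U (k : κ) : Cocycle P ((singleFunctor _ 0).obj Q) 1 :=
    Cocycle.toSingleMk (u k) (by lia : -1 + 1 = 0) (-2) (by lia)
      ((P.isZero_of_isStrictlyGE (-1) (-2)).eq_of_src _ _)
  -- `W` is only a cochain: the failure of the `w i` to kill `d` is what `hu` records.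
  let W : Cochain F ((singleFunctor _ 0).obj Q) 0 :=
    ∑ i, (Cochain.ofHom (p i)).comp (Cochain.toSingleMk (w i) (add_zero 0))
      (add_zero 0)
  have h₁ : (Cochain.ofHom φ).comp W (add_zero 0) = Cochain.ofHom (𝟙 _) +
      ∑ k, ((mappingCone.inl φ).comp (Cochain.ofHom (V k)) (add_zero (-1))).comp (U k).1
        (by lia : -1 + 1 = 0) := by
    have e₁ (i : ι) : (Cochain.ofHom φ).comp ((Cochain.ofHom (p i)).comp
        (Cochain.toSingleMk (w i) (add_zero 0)) (add_zero 0)) (add_zero 0) =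
          Cochain.ofHom ((singleFunctor _ 0).map (x i ≫ w i)) := by
      rw [← Cochain.comp_assoc_of_first_is_zero_cochain, ← Cochain.ofHom_comp, hφ, hφ',
        fromSingleMk_comp_toSingleMk]
    have e₂ (k : κ) : ((mappingCone.inl φ).comp (Cochain.ofHom (V k)) (add_zero (-1))).comp
        (U k).1 (by lia : -1 + 1 = 0) = Cochain.ofHom ((singleFunctor _ 0).map (y k ≫ u k)) := by
      dsimp only [V, U, α]
      rw [mappingCone.inl_desc]
      exact fromSingleMk_comp_toSingleMk _ _ _ (by lia) _
    dsimp only [W]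
    rw [cochain_comp_sum]
    simp only [e₁, e₂]
    rw [← cochain_ofHom_sum, ← cochain_ofHom_sum, ← Functor.map_sum, ← Functor.map_sum, hw,
      Functor.map_add, CategoryTheory.Functor.map_id, Cochain.ofHom_add]
  have h₂ : δ 0 1 W = - ∑ k, (Cochain.ofHom (mappingCone.inr φ ≫ V k)).comp (U k).1
      (zero_add 1) := by
    have e₁ (i : ι) : δ 0 1 ((Cochain.ofHom (p i)).comp
        (Cochain.toSingleMk (w i) (add_zero 0)) (add_zero 0)) =
          - Cochain.toSingleMk ((p i).f (-1) ≫ P.d (-1) 0 ≫ w i)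
            (by lia : -1 + 1 = 0) := by
      rw [Cochain.toSingleMk_precomp, ← Cocycle.ofHom_coe, δ_zero_cocycle_comp,
        Cochain.δ_toSingleMk _ _ _ (-1) (by lia)]
      simp
    have e₂ (k : κ) : (Cochain.ofHom (mappingCone.inr φ ≫ V k)).comp (U k).1 (zero_add 1) =
        Cochain.toSingleMk (∑ i, (p i).f (-1) ≫ g₁ i k ≫ u k)
          (by lia : -1 + 1 = 0) := by
      have : (G k).f (-1) ≫ u k =
          ∑ i, (p i).f (-1) ≫ g₁ i k ≫ u k := by
        have hG : (G k).f (-1) = ∑ i, (p i ≫ g i k).f (-1) :=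
          (HomologicalComplex.eval _ _ (-1)).map_sum _ _
        rw [hG, Preadditive.sum_comp]
        refine Finset.sum_congr rfl fun i _ ↦ ?_
        rw [HomologicalComplex.comp_f, hg₁, Category.assoc]
      rw [← this, Cochain.toSingleMk_precomp, mappingCone.inr_desc]
      rfl
    dsimp only [W]
    rw [cochain_δ_sum]
    simp only [e₁, e₂, hu]
    rw [Finset.sum_neg_distrib]
    congr 1
    trans Cochain.toSingleMk (∑ i, ∑ k, (p i).f (-1) ≫ g₁ i k ≫ u k)
          (by lia : -1 + 1 = 0)
    · simp only [Preadditive.comp_sum]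
      exact (map_sum (Cochain.toSingleEquiv (by lia : (-1 : ℤ) + 1 = 0)).symm _ _).symm
    · rw [Finset.sum_comm]
      exact map_sum (Cochain.toSingleEquiv (by lia : (-1 : ℤ) + 1 = 0)).symm _ _
  have hmem := fst_add_sum_mem_coboundaries φ V U W h₁ h₂
  let q := HomotopyCategory.quotient (ModuleCat.{u} A) (ComplexShape.up ℤ)
  have hmor : (mappingCone.triangleh φ).mor₃ = ∑ k, q.map (V k) ≫
      (q.map (Cocycle.equivHomShift.symm (U k)) ≫
        (q.commShiftIso (1 : ℤ)).hom.app ((singleFunctor _ 0).obj Q)) := by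
    have h0 := (CohomologyClass.toHom_mk_eq_zero_iff _).2 hmem
    rw [CohomologyClass.toHom_mk, map_add, map_sum, Functor.map_add, Functor.map_sum,
      add_eq_zero_iff_neg_eq, ← Functor.map_neg, ← map_neg] at h0
    change q.map (Cocycle.equivHomShift.symm (-mappingCone.fst φ)) ≫ _ = _
    refine (congrArg (· ≫ (q.commShiftIso (1 : ℤ)).hom.app
      ((singleFunctor _ 0).obj Q)) h0).trans ((Preadditive.sum_comp _ _ _).trans ?_)
    refine Finset.sum_congr rfl fun k _ ↦ ?_
    rw [Cocycle.equivHomShift_symm_precomp, Functor.map_comp, Category.assoc]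
  have hid : ∑ i, q.map (p i) ≫ q.map (j i) =
      𝟙 (q.obj F) := by
    simp only [← Functor.map_comp]
    rw [← Functor.map_sum, hpj, q.map_id]
  have hdist := HomotopyCategory.mappingCone_triangleh_distinguished φ
  obtain ⟨a, b, hab⟩ := exists_sum_eq_id_of_distinguished hdist hrigid _ _ hid _ _ hmor
  exact S.ext_of_isTriangulatedClosed₁ _ hdist (hS _ (addClosure_of_sum_eq_id P _ _ hid))
    (hS _ (addClosure_of_sum_eq_id P _ _ hab))

end Cone

/-! ### The implications between the three conditions -/

section Main

variable {A : Type u} [Ring A]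

lemma isBoundedProj_single (b : ℤ) (Q : ModuleCat.{u} A) [Module.Finite A Q]
    [Module.Projective A Q] :
    IsBoundedProj ((HomologicalComplex.single _ (.up ℤ) b).obj Q) := by
  have hX (i : ℤ) : Subsingleton (((HomologicalComplex.single _ (.up ℤ) b).obj Q).X i) ∨
      Nonempty (Q ≃ₗ[A] ((HomologicalComplex.single _ (.up ℤ) b).obj Q).X i) := by
    by_cases hi : i = b
    · subst hi
      exact Or.inr ⟨(HomologicalComplex.singleObjXSelf (.up ℤ) i Q).symm.toLinearEquiv⟩
    · exact Or.inl (ModuleCat.subsingleton_of_isZero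
        (HomologicalComplex.isZero_single_obj_X _ _ _ _ hi))
  exact
    { bounded := ⟨b, b, inferInstance, inferInstance⟩
      finite i := by
        obtain h | ⟨⟨e⟩⟩ := hX i
        · infer_instance
        · exact Module.Finite.equiv e
      projective i := by
        obtain h | ⟨⟨e⟩⟩ := hX i
        · infer_instance
        · exact Module.Projective.of_equiv e }

variable (P : CochainComplex (ModuleCat.{u} A) ℤ) [P.IsStrictlyGE (-1)] [P.IsStrictlyLE 0]

variable {P} in
lemma IsTiltingComplex.subsingleton_of_precomp (hP : IsTiltingComplex P)
    (N : ModuleCat.{u} A) (hX : PrecompSurj (P.d (-1) 0).hom N)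
    (hY : PrecompInj (P.d (-1) 0).hom N) : Subsingleton N := by
  -- Closing under shifts makes the left orthogonal a triangulated subcategory.
  let R := (ObjectProperty.singleton
    (toK ((CochainComplex.singleFunctor (ModuleCat.{u} A) 0).obj N))).shiftClosure ℤ
  have hPR : R.leftOrthogonal (toK P) := by
    rintro Y f ⟨Z, n, e, hZ⟩
    obtain rfl := (ObjectProperty.singleton_iff _ _).1 hZ
    have : Subsingleton (toK P ⟶
        (toK ((CochainComplex.singleFunctor (ModuleCat.{u} A) 0).obj N))⟦n⟧) := by
      by_cases h₀ : n = 0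
      · subst h₀
        exact (subsingleton_hom_shift_single_zero_iff P N).2 hY
      by_cases h₁ : n = 1
      · subst h₁
        exact (subsingleton_hom_shift_single_one_iff P N).2 hX
      exact subsingleton_hom_shift_single_of_ne P N n h₀ h₁
    rw [← cancel_mono e.hom]
    exact Subsingleton.elim _ _
  have hA := hP.generates R.leftOrthogonal inferInstance inferInstance
    (leftOrthogonal_of_addClosure P R hPR) _ (isBoundedProj_single 0 (ModuleCat.of A A))
  have hsub : Subsingleton (toK ((HomologicalComplex.single _ (.up ℤ) 0).obj (ModuleCat.of A A)) ⟶
      (toK ((CochainComplex.singleFunctor (ModuleCat.{u} A) 0).obj N))⟦(0 : ℤ)⟧) :=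
    ⟨fun f g ↦ by
      have hR : R ((toK ((CochainComplex.singleFunctor (ModuleCat.{u} A) 0).obj N))⟦(0 : ℤ)⟧) :=
        ⟨_, 0, Iso.refl _, (ObjectProperty.singleton_iff _ _).2 rfl⟩
      rw [hA f hR, hA g hR]⟩
  rw [subsingleton_hom_shift_single_iff _ N 0 (-1) 0 1 0 (by lia) (by lia) (by lia)] at hsub
  refine subsingleton_of_forall_eq 0 fun x ↦ ?_
  let e := HomologicalComplex.singleObjXSelf (.up ℤ) 0 (ModuleCat.of A A)
  -- An element `x` of `N` is a map `A → N`, which must factor through the zero differential.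
  obtain ⟨g, hg⟩ := hsub (e.hom ≫ ModuleCat.ofHom (LinearMap.toSpanSingleton A N x))
    (by simp)
  have h0 : ModuleCat.ofHom (LinearMap.toSpanSingleton A N x) = 0 := by
    rw [← cancel_epi e.hom, ← hg]
    simp
  simpa using LinearMap.congr_fun (congrArg ModuleCat.Hom.hom h0) (1 : A)

lemma isTiltingComplex_of_isRigid (hfin : ∀ i, Module.Finite A (P.X i))
    (hproj : ∀ i, Module.Projective A (P.X i)) (hd : IsRigid (P.d (-1) 0).hom)
    (hneg : ∀ f : P.X 0 →ₗ[A] P.X (-1), (P.d (-1) 0).hom ∘ₗ f = 0 →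
      f ∘ₗ (P.d (-1) 0).hom = 0 → f = 0)
    (hz : ∀ (N : Type u) [AddCommGroup N] [Module A N], PrecompSurj (P.d (-1) 0).hom N →
      PrecompInj (P.d (-1) 0).hom N → Subsingleton N) : IsTiltingComplex P where
  isBoundedProj := ⟨⟨-1, 0, inferInstance, inferInstance⟩, hfin, hproj⟩
  hom_shift_eq_zero n hn := by
    by_cases h₁ : n = 1
    · subst h₁
      exact (subsingleton_hom_shift_one_iff_isRigid P).2 hd
    by_cases h₂ : n = -1
    · subst h₂
      exact (subsingleton_hom_shift_neg_one_iff P).2 hneg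
    exact subsingleton_hom_shift_of_ne P n hn h₁ h₂
  generates S _ _ hS K hK := by
    refine prop_toK_of_isBoundedProj S (fun b Q _ _ ↦ ?_) K hK
    have := hfin 0
    have := hfin (-1)
    have := hproj 0
    have := hproj (-1)
    obtain ⟨ι, κ, _, _, x, g₀, g₁, w, y, u, hg, hy, hw, hu⟩ := hd.exists_matrices hz Q
    have h0 := prop_single_of_matrices Q (fun i ↦ ModuleCat.ofHom (x i))
      (fun i k ↦ ModuleCat.ofHom (g₀ i k)) (fun i k ↦ ModuleCat.ofHom (g₁ i k))
      (fun i ↦ ModuleCat.ofHom (w i)) (fun k ↦ ModuleCat.ofHom (y k))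
      (fun k ↦ ModuleCat.ofHom (u k))
      (fun i k ↦ by ext : 1; simpa using hg i k)
      (fun k ↦ by ext : 1; simpa [ModuleCat.hom_sum] using hy k)
      (by ext : 1; simpa [ModuleCat.hom_sum] using hw)
      (fun i ↦ by ext : 1; simpa [ModuleCat.hom_sum] using hu i)
      ((subsingleton_hom_shift_one_iff_isRigid P).2 hd) S hS
    exact S.prop_of_iso (((HomotopyCategory.singleFunctors (ModuleCat.{u} A)).shiftIso
      (-b) b 0 (by lia)).app Q) (S.le_shift (-b) _ h0)

variable {P} [HasDerivedCategory.{w} (ModuleCat.{u} A)]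

lemma classX_inf_classY_eq_isZero_iff (hproj : ∀ i, Module.Projective A (P.X i)) :
    classX P ⊓ classY P = IsZero ↔
      ∀ (N : Type u) [AddCommGroup N] [Module A N], PrecompSurj (P.d (-1) 0).hom N →
        PrecompInj (P.d (-1) 0).hom N → Subsingleton N := by
  constructor
  · intro h N _ _ hX hY
    have hN : (classX P ⊓ classY P) (ModuleCat.of A N) :=
      ⟨(classX_iff hproj _).2 hX, (classY_iff hproj _).2 hY⟩
    rw [h] at hN
    exact ModuleCat.subsingleton_of_isZero hN
  · intro h
    ext N
    constructor
    · rintro ⟨hX, hY⟩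
      have := h N ((classX_iff hproj _).1 hX) ((classY_iff hproj _).1 hY)
      exact ModuleCat.isZero_of_iff_subsingleton.2 this
    · intro hN
      have := ModuleCat.subsingleton_of_isZero hN
      exact ⟨(classX_iff hproj _).2 fun f ↦ ⟨0, Subsingleton.elim _ _⟩,
        (classY_iff hproj _).2 fun g _ ↦ Subsingleton.elim _ _⟩

lemma isTorsionTheory_of_isRigid (hfin : ∀ i, Module.Finite A (P.X i))
    (hproj : ∀ i, Module.Projective A (P.X i)) (hd : IsRigid (P.d (-1) 0).hom)
    (hz : classX P ⊓ classY P = IsZero) : IsTorsionTheory (classX P) (classY P) where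
  inter_eq_zero := hz
  quotient_closed :=
    { prop_of_epi := fun f _ hX ↦ by
        have := hproj (-1)
        exact (classX_iff hproj _).2 (((classX_iff hproj _).1 hX).of_surjective f.hom
          ((ModuleCat.epi_iff_surjective f).1 inferInstance)) }
  subobject_closed :=
    { prop_of_mono := fun f _ hY ↦
        (classY_iff hproj _).2 (((classY_iff hproj _).1 hY).of_injective f.hom
          ((ModuleCat.mono_iff_injective f).1 inferInstance)) }
  exists_sequence M := by
    have := hfin (-1)
    have := hproj 0
    have := hproj (-1)
    let T := LinearMap.range (traceMap (P.d (-1) 0).hom M)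
    refine ⟨ModuleCat.of A T, ModuleCat.of A (M ⧸ T), ModuleCat.ofHom T.subtype,
      ModuleCat.ofHom T.mkQ, by ext; simp, ?_, (classX_iff hproj _).2
      hd.precompSurj_range_traceMap, (classY_iff hproj _).2 hd.precompInj_quotient_range_traceMap⟩
    exact
      { exact := (ShortComplex.moduleCat_exact_iff_range_eq_ker _).2 (by simp)
        mono_f := (ModuleCat.mono_iff_injective _).2 T.subtype_injective
        epi_g := (ModuleCat.epi_iff_surjective _).2 T.mkQ_surjective }

-- The map from `P₀` to the torsion-free quotient of `H⁰(P)` kills `d`, hence is zero. So the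
-- torsion part maps onto `H⁰(P)`.
omit [P.IsStrictlyGE (-1)] in
lemma IsTorsionTheory.classX_homology_zero (hproj : ∀ i, Module.Projective A (P.X i))
    (h : IsTorsionTheory (classX P) (classY P)) : classX P (P.homology 0) := by
  obtain ⟨M', M'', i, p, zero, hS, hX, hY⟩ := h.exists_sequence (P.homology 0)
  obtain ⟨π, hπ, hk⟩ := exists_presentation_homology_zero P
  have hp : p.hom ∘ₗ π = 0 := (classY_iff hproj _).1 hY _ (by
    rw [LinearMap.comp_assoc, LinearMap.range_le_ker_iff.mp hk.le, LinearMap.comp_zero])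
  have hp0 : p = 0 := by
    ext x
    obtain ⟨z, rfl⟩ := hπ x
    exact LinearMap.congr_fun hp z
  have : Epi i := (ShortComplex.exact_iff_epi _ hp0).1 hS.exact
  have := h.quotient_closed
  exact (classX P).prop_of_epi i hX

end Main

end TwoTermTilting

end

/-- For a complex `P`, concentrated in degrees `-1` and `0`, of finitely generated projective left
modules over a ring `A`, three equivalent conditions: `P` is a tilting complex; the classes `X(P)`
and `Y(P)` meet in `0` only, `H⁰(P)` lies in `X(P)` and `H⁻¹(P)` lies in `Y(P)`; the pair
`(X(P), Y(P))` is a torsion theory for the category of `A`-modules and `H⁻¹(P)` lies in `Y(P)`. -/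
theorem corollary3p6 {A : Type u} [Ring A] [HasDerivedCategory.{w} (ModuleCat.{u} A)]
    (P : CochainComplex (ModuleCat.{u} A) ℤ)
    (hGE : P.IsStrictlyGE (-1)) (hLE : P.IsStrictlyLE 0)
    (hfin : ∀ i, Module.Finite A (P.X i)) (hproj : ∀ i, Module.Projective A (P.X i)) :
    List.TFAE [
      TwoTermTilting.IsTiltingComplex P,
      TwoTermTilting.classX P ⊓ TwoTermTilting.classY P = IsZero ∧
        TwoTermTilting.classX P (P.homology 0) ∧
        TwoTermTilting.classY P (P.homology (-1)),
      TwoTermTilting.IsTorsionTheory (TwoTermTilting.classX P) (TwoTermTilting.classY P) ∧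
        TwoTermTilting.classY P (P.homology (-1))] := by
  open TwoTermTilting in
  have hX := (classX_iff hproj (P.homology 0)).trans (precompSurj_homology_iff_isRigid P hproj)
  have hY := (classY_iff hproj (P.homology (-1))).trans (precompInj_homology_iff P)
  tfae_have 1 → 2 := fun h ↦
    ⟨(classX_inf_classY_eq_isZero_iff hproj).2 fun N _ _ ↦
      h.subsingleton_of_precomp (ModuleCat.of A N),
      hX.2 ((subsingleton_hom_shift_one_iff_isRigid P).1 (h.hom_shift_eq_zero 1 (by lia))),
      hY.2 ((subsingleton_hom_shift_neg_one_iff P).1 (h.hom_shift_eq_zero (-1) (by lia)))⟩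
  tfae_have 2 → 1 := fun ⟨h₁, h₂, h₃⟩ ↦
    isTiltingComplex_of_isRigid P hfin hproj (hX.1 h₂) (hY.1 h₃)
      ((classX_inf_classY_eq_isZero_iff hproj).1 h₁)
  tfae_have 2 → 3 := fun ⟨h₁, h₂, h₃⟩ ↦
    ⟨isTorsionTheory_of_isRigid hfin hproj (hX.1 h₂) h₁, h₃⟩
  tfae_have 3 → 2 := fun ⟨h₁, h₂⟩ ↦
    ⟨h₁.inter_eq_zero, h₁.classX_homology_zero hproj, h₂⟩
  tfae_finish
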